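/- **Setting.** A Markov decision process (MDP) consists of a finite directed graph in which every vertex has a successor, and a partition of the vertices into player-1 vertices and random vertices; at a random vertex the next vertex is uniformly distributed over the successors, at a player-1 vertex it is chosen by a strategy $\sigma$, which may depend on the whole history. For a set $T$ of vertices, $\mathrm{Safety}(T)$ is the set of infinite paths that never visit $T$. For an MDP $P$ and a set $\psi$ of infinite paths, the almost-sure winning set $\langle\!\langle 1\rangle\!\rangle_{as}(P,\psi)$ is the set of vertices $v$ for which some strategy $\sigma$ satisfies $\Pr^{\sigma}_v(\psi)=1$. Given an MDP $P$ with $m$ edges and target sets $T_1,\dots,T_k$, the winning set of the *disjunctive safety objective* is $\langle\!\langle 1\rangle\!\rangle_{as}(P,\bigcup_i \mathrm{Safety}(T_i))$, and that of the *disjunctive safety query* is $\bigcup_i \langle\!\langle 1\rangle\!\rangle_{as}(P,\mathrm{Safety}(T_i))$. Algorithms are (deterministic) word RAM programs whose word length is at least a constant times the logarithm of input length plus running time; time is the number of instructions. *Orthogonal Vectors Conjecture (OVC):* for every $\varepsilon>0$ there is a $c$ such that no algorithm decides in time $O(N^{2-\varepsilon})$, given two collections $S_1,S_2$ of at most $N$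 vectors in $\{0,1\}^d$ with $d\le c\log N$, whether there are $u\in S_1$, $v\in S_2$ with $\sum_i u_iv_i=0$. *Strong Exponential Time Hypothesis (SETH):* for every $\varepsilon>0$ there is a $q$ such that satisfiability of CNF formulas with $n$ variables and $M$ clauses of at most $q$ literals each cannot be decided in time $O(2^{(1-\varepsilon)n}\,\mathrm{poly}(M))$. **Theorem.** Assume that OVC or SETH holds. Then for no $\varepsilon>0$ is there an algorithm that runs in time $O(m^{2-\varepsilon})$, or one that runs in time $O((k\cdot m)^{1-\varepsilon})$, for any of the following problems, each both for disjunctive safety objectives and for disjunctive safety queries in MDPs: 1. computing the almost-sure winning set; 2. deciding whether the almost-sure winning set is non-empty; 3. deciding whether a given vertex belongs to the almost-sure winning set. This remains true if time linear in the length $\ell$ of the input is allowed in addition, that is, for the time bounds $O(\ell+m^{2-\varepsilon})$ and $O(\ell+(k\cdot m)^{1-\varepsilon})$. -/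

import Mathlib

noncomputable section

namespace SafetyHardness

/-! ## The word RAM

A machine with word length `w` has registers and a random access memory, all of whose cells hold
natural numbers below `2 ^ w`.  Every instruction takes one time step. -/

/-- Binary operations on words. -/
inductive WordOp
  | add | sub | mul | div | mod | and | or | xor | shl | shr

/-- The value of a word operation; all results are reduced modulo `2 ^ w`, and subtraction is
subtraction modulo `2 ^ w`. -/
def WordOp.eval (w : ℕ) : WordOp → ℕ → ℕ → ℕ
  | .add, a, b => (a + b) % 2 ^ w
  | .sub, a, b => (a + (2 ^ w - b)) % 2 ^ w
  | .mul, a, b => (a * b) % 2 ^ w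
  | .div, a, b => (a / b) % 2 ^ w
  | .mod, a, b => (a % b) % 2 ^ w
  | .and, a, b => (a &&& b) % 2 ^ w
  | .or, a, b => (a ||| b) % 2 ^ w
  | .xor, a, b => (a ^^^ b) % 2 ^ w
  | .shl, a, b => (a <<< b) % 2 ^ w
  | .shr, a, b => (a >>> b) % 2 ^ w

/-- Instructions; `r s t` are names of registers, `l` is a line of the program. -/
inductive Instr
  /-- put the constant `a` into register `r` -/
  | const (r a : ℕ)
  /-- put the result of the operation `o`, applied to registers `s` and `t`, into register `r` -/
  | op (o : WordOp) (r s t : ℕ)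
  /-- put the memory cell whose address is in register `s` into register `r` -/
  | load (r s : ℕ)
  /-- put register `s` into the memory cell whose address is in register `r` -/
  | store (r s : ℕ)
  /-- go to line `l` -/
  | jump (l : ℕ)
  /-- go to line `l` if register `r` is zero -/
  | jumpZero (r l : ℕ)
  /-- go to line `l` if register `r` is less than register `s` -/
  | jumpLt (r s l : ℕ)

/-- A program is a finite list of instructions.  It halts when the program counter leaves the
list. -/
abbrev Program := List Instr

/-- Configurations: program counter, registers, memory. -/
structure Config where
  pc : ℕ
  reg : ℕ → ℕ
  mem : ℕ → ℕ

/-- The effect of one instruction on a machine with word length `w`. -/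
def Instr.exec (w : ℕ) (c : Config) : Instr → Config
  | .const r a => ⟨c.pc + 1, Function.update c.reg r (a % 2 ^ w), c.mem⟩
  | .op o r s t => ⟨c.pc + 1, Function.update c.reg r (o.eval w (c.reg s) (c.reg t)), c.mem⟩
  | .load r s => ⟨c.pc + 1, Function.update c.reg r (c.mem (c.reg s)), c.mem⟩
  | .store r s => ⟨c.pc + 1, c.reg, Function.update c.mem (c.reg r) (c.reg s)⟩
  | .jump l => ⟨l, c.reg, c.mem⟩
  | .jumpZero r l => ⟨if c.reg r = 0 then l else c.pc + 1, c.reg, c.mem⟩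
  | .jumpLt r s l => ⟨if c.reg r < c.reg s then l else c.pc + 1, c.reg, c.mem⟩

/-- One step of the program `P`; halted configurations do not change. -/
def Program.step (P : Program) (w : ℕ) (c : Config) : Config :=
  match P[c.pc]? with
  | some i => i.exec w c
  | none => c

/-- The initial configuration: the input word sequence is in the memory cells `0, 1, 2, …`, and
everything else is zero. -/
def Config.init (x : List ℕ) : Config := ⟨0, fun _ => 0, fun i => x.getD i 0⟩

/-- Started on input `x` with word length `w`, the program halts after at most `t` steps with
memory content `mem`. -/
def Program.HaltsWith (P : Program) (w : ℕ) (x : List ℕ) (t : ℕ) (mem : ℕ → ℕ) : Prop :=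
  P.length ≤ ((P.step w)^[t] (Config.init x)).pc ∧ ((P.step w)^[t] (Config.init x)).mem = mem

/-- An algorithmic problem: instances, their encoding as sequences of numbers, and the memory
contents that are correct answers. -/
structure Problem where
  Inst : Type
  encode : Inst → List ℕ
  Correct : Inst → (ℕ → ℕ) → Prop

/-- The length of the input. -/
def Problem.length (Q : Problem) (x : Q.Inst) : ℕ := (Q.encode x).length

/-- Decision problems are answered in memory cell `0`, by `1` for yes and `0` for no. -/
def DecisionAnswer (p : Prop) (mem : ℕ → ℕ) : Prop := (p → mem 0 = 1) ∧ (¬ p → mem 0 = 0)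

/-- `Q` is solved by an algorithm in time `T`.  The word length has to be at least a constant
multiple of the logarithm of (input length + time), so that a word can hold an address, and large
enough to hold each number of the input. -/
def Problem.SolvableInTime (Q : Problem) (T : Q.Inst → ℝ) : Prop :=
  ∃ (P : Program) (c : ℕ), ∀ (x : Q.Inst) (w : ℕ),
    ((2 + Q.length x + T x : ℝ) ^ c ≤ 2 ^ w) → (∀ a ∈ Q.encode x, a < 2 ^ w) →
      ∃ (t : ℕ) (mem : ℕ → ℕ), (t : ℝ) ≤ T x ∧ P.HaltsWith w (Q.encode x) t mem ∧ Q.Correct x mem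

/-- `Q` is solved by an algorithm in time `O(f)`. -/
def Problem.SolvableInBigO (Q : Problem) (f : Q.Inst → ℝ) : Prop :=
  ∃ C : ℝ, Q.SolvableInTime (fun x => C * f x)

/-! ## Orthogonal vectors and satisfiability -/

/-- Two collections of `d`-bit vectors. -/
structure OVInstance where
  d : ℕ
  S₁ : List (Fin d → Bool)
  S₂ : List (Fin d → Bool)

namespace OVInstance

/-- The size parameter: both collections have at most `N` elements. -/
def N (x : OVInstance) : ℕ := max x.S₁.length x.S₂.length

/-- Some `u ∈ S₁` and `v ∈ S₂` have inner product `0`. -/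
def HasOrthogonalPair (x : OVInstance) : Prop :=
  ∃ u ∈ x.S₁, ∃ v ∈ x.S₂, ∑ i, (u i).toNat * (v i).toNat = 0

/-- Dimension, sizes of the collections, and all the bits. -/
def encode (x : OVInstance) : List ℕ :=
  [x.d, x.S₁.length, x.S₂.length] ++
    (x.S₁ ++ x.S₂).flatMap fun u => List.ofFn fun i => (u i).toNat

end OVInstance

/-- The orthogonal vectors problem in dimension `d ≤ c · log N`. -/
def OVProblem (c : ℕ) : Problem where
  Inst := {x : OVInstance // x.d ≤ c * Nat.log 2 x.N}
  encode x := x.1.encode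
  Correct x := DecisionAnswer x.1.HasOrthogonalPair

/-- Orthogonal Vectors Conjecture: for no `ε > 0` are there `O(N ^ (2 - ε))` time algorithms for
the orthogonal vectors problem in dimension `O(log N)`. -/
def OVC : Prop :=
  ∀ ε : ℝ, 0 < ε → ∃ c : ℕ,
    ¬ (OVProblem c).SolvableInBigO fun x => ((x.1.N : ℝ) + 1) ^ (2 - ε)

/-- A CNF formula with `n` variables.  A literal is a variable with a sign. -/
structure CNF where
  n : ℕ
  clauses : List (List (Fin n × Bool))

namespace CNF

/-- The number of clauses. -/
def m (φ : CNF) : ℕ := φ.clauses.length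

def Satisfiable (φ : CNF) : Prop :=
  ∃ a : Fin φ.n → Bool, ∀ C ∈ φ.clauses, ∃ l ∈ C, a l.1 = l.2

/-- Number of variables, number of clauses, and each clause with its length. -/
def encode (φ : CNF) : List ℕ :=
  [φ.n, φ.m] ++ φ.clauses.flatMap fun C => C.length :: C.map fun l => 2 * l.1.val + l.2.toNat

end CNF

/-- Satisfiability of CNF formulas all of whose clauses have at most `k` literals. -/
def kSATProblem (k : ℕ) : Problem where
  Inst := {φ : CNF // ∀ C ∈ φ.clauses, C.length ≤ k}
  encode φ := φ.1.encode
  Correct φ := DecisionAnswer φ.1.Satisfiable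

/-- Strong Exponential Time Hypothesis: for each `ε > 0` there is a `k` such that `k`-CNF-SAT is
not solvable in time `O(2 ^ ((1 - ε) n) · poly(m))`. -/
def SETH : Prop :=
  ∀ ε : ℝ, 0 < ε → ∃ k : ℕ, ∀ a : ℕ,
    ¬ (kSATProblem k).SolvableInBigO fun φ =>
      (2 : ℝ) ^ ((1 - ε) * (φ.1.n : ℝ)) * ((φ.1.m : ℝ) + 1) ^ a

/-! ## Markov decision processes -/

/-- A Markov decision process with vertices `0, …, n - 1`: a directed graph in which every vertex
has a successor, and the set of random vertices; the other vertices belong to player 1.  At a random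
vertex the next vertex is uniformly distributed over the successors. -/
structure MDP (n : ℕ) where
  succ : Fin n → Finset (Fin n)
  succ_nonempty : ∀ v, (succ v).Nonempty
  random : Finset (Fin n)

/-- A finite sequence of vertices `v₀, …, v_j`. -/
abbrev History (n j : ℕ) := Finset.Iic j → Fin n

/-- The last vertex of a history. -/
def History.last {n j : ℕ} (h : History n j) : Fin n := h ⟨j, Finset.mem_Iic.2 le_rfl⟩

namespace MDP

variable {n : ℕ} (P : MDP n)

/-- A player 1 strategy chooses a successor for every history that ends in a player 1 vertex (its
values on histories that end in a random vertex are irrelevant). -/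
structure Strategy where
  next : ∀ j, History n j → Fin n
  next_mem : ∀ j (h : History n j), h.last ∉ P.random → next j h ∈ P.succ h.last

variable {P}

/-- The distribution of the next vertex after a history when player 1 plays `σ`. -/
def Strategy.stepMeasure (σ : P.Strategy) (j : ℕ) (h : History n j) :
    MeasureTheory.Measure (Fin n) :=
  if h.last ∈ P.random then
    (PMF.uniformOfFinset (P.succ h.last) (P.succ_nonempty h.last)).toMeasure
  else MeasureTheory.Measure.dirac (σ.next j h)

/-- `stepMeasure` as a transition kernel. -/
def Strategy.kernel (σ : P.Strategy) (j : ℕ) :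
    ProbabilityTheory.Kernel (History n j) (Fin n) :=
  ProbabilityTheory.Kernel.ofFunOfCountable (σ.stepMeasure j)

instance Strategy.isMarkovKernel_kernel (σ : P.Strategy) (j : ℕ) :
    ProbabilityTheory.IsMarkovKernel (σ.kernel j) := by
  refine ⟨fun h => ?_⟩
  change MeasureTheory.IsProbabilityMeasure (σ.stepMeasure j h)
  unfold Strategy.stepMeasure
  split_ifs <;> infer_instance

/-- The law of the infinite path that starts at `v` when player 1 plays `σ`. -/
def Strategy.prob (σ : P.Strategy) (v : Fin n) : MeasureTheory.Measure (ℕ → Fin n) :=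
  ProbabilityTheory.Kernel.traj (X := fun _ => Fin n) σ.kernel 0 (fun _ => v)

variable (P)

/-- The set of plays (infinite paths). -/
def plays : Set (ℕ → Fin n) := {ω | ∀ i, ω (i + 1) ∈ P.succ (ω i)}

/-- The safety objective: plays that never visit `T`. -/
def safety (T : Finset (Fin n)) : Set (ℕ → Fin n) := {ω ∈ P.plays | ∀ j, ω j ∉ T}

/-- The almost-sure winning set of an objective. -/
def almostSure (ψ : Set (ℕ → Fin n)) : Set (Fin n) := {v | ∃ σ : P.Strategy, σ.prob v ψ = 1}

/-- The number of edges. -/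
def numEdges : ℕ := ∑ v, (P.succ v).card

end MDP

/-! ## Disjunctive safety -/

/-- An MDP with a list of target sets. -/
structure SafetyInstance where
  n : ℕ
  mdp : MDP n
  targets : List (Finset (Fin n))

/-- The disjunction of the safety objectives can be an objective (the union of the objectives) or a
query (the union of the winning sets). -/
inductive Disjunction
  | objective | query

/-- The numbers in a finite set of vertices, in increasing order, after their quantity. -/
def encodeFinset {n : ℕ} (s : Finset (Fin n)) : List ℕ := s.card :: (s.sort).map Fin.val

namespace SafetyInstance

/-- The number of edges. -/
def m (x : SafetyInstance) : ℕ := x.mdp.numEdges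

/-- The number of safety objectives. -/
def k (x : SafetyInstance) : ℕ := x.targets.length

/-- The almost-sure winning set for the disjunctive safety objective or query. -/
def winningSet (x : SafetyInstance) : Disjunction → Set (Fin x.n)
  | .objective => x.mdp.almostSure (⋃ T ∈ x.targets, x.mdp.safety T)
  | .query => ⋃ T ∈ x.targets, x.mdp.almostSure (x.mdp.safety T)

/-- Number of vertices; for each vertex whether it is random, and its successors; number of target
sets; the target sets. -/
def encode (x : SafetyInstance) : List ℕ :=
  x.n :: (List.finRange x.n).flatMap
      (fun v => (if v ∈ x.mdp.random then 1 else 0) :: encodeFinset (x.mdp.succ v))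
    ++ x.k :: x.targets.flatMap encodeFinset

end SafetyInstance

/-- Computing the winning set: memory cell `v` has to indicate whether vertex `v` is in it. -/
def winningSetProblem (D : Disjunction) : Problem where
  Inst := SafetyInstance
  encode x := x.encode
  Correct x mem := ∀ v : Fin x.n,
    (v ∈ x.winningSet D → mem v = 1) ∧ (v ∉ x.winningSet D → mem v = 0)

/-- Deciding whether the winning set is nonempty. -/
def nonemptinessProblem (D : Disjunction) : Problem where
  Inst := SafetyInstance
  encode x := x.encode
  Correct x := DecisionAnswer (x.winningSet D).Nonempty

/-- Deciding whether a given vertex is in the winning set. -/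
def membershipProblem (D : Disjunction) : Problem where
  Inst := Σ x : SafetyInstance, Fin x.n
  encode y := y.2.val :: y.1.encode
  Correct y := DecisionAnswer (y.2 ∈ y.1.winningSet D)

/-- For no `ε > 0` is there an algorithm for `Q` that runs in time `O(m ^ (2 - ε))` or
`O((k m) ^ (1 - ε))`, where `inst` is the underlying MDP with target sets, even if time linear in the
length of the input is added to these bounds. -/
def NoFastAlgorithm (Q : Problem) (inst : Q.Inst → SafetyInstance) : Prop :=
  ∀ ε : ℝ, 0 < ε →
    ¬ (Q.SolvableInBigO fun x => Q.length x + ((inst x).m : ℝ) ^ (2 - ε)) ∧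
    ¬ (Q.SolvableInBigO fun x => Q.length x + (((inst x).k : ℝ) * (inst x).m) ^ (1 - ε))

end SafetyHardness

end

noncomputable section

namespace SafetyHardness

/-! Orthogonal vectors reduces to each of the six problems through an MDP with O(N) target sets and
O(N d) edges. From the start vertex player 1 moves to a vertex for some `u ∈ S₁`; a random move
leads from there back to the start or to a vertex that stands for a coordinate of `u` and its bit;
coordinate vertices lead back to the start. The target set of `v ∈ S₂` contains the vertices
"coordinate j of u is 1" with `v j = 1`. If `u` and `v` are orthogonal, then always choosing `u`
avoids the target of `v` (`OVInstance.start_mem_winningSet_query`).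

Otherwise fix any strategy. With positive probability the play visits all of some nonempty set `Z`
that contains every successor of its random vertices and some successor of each of its player 1
vertices (`MDP.Strategy.exists_closed`). In this graph such a `Z` contains the start vertex, hence
one of its successors, hence a vertex of every target. So even the objective has an empty winning
set (`OVInstance.winningSet_objective_eq_empty`). As the winning set of the query lies in that of
the objective, all six problems answer the orthogonal vectors question.

Both time bounds, and the input length, become O((d+1)² (N+1)^(2-ε')) with ε' = min ε 1. For d =
O(log N) the factor (d+1)² costs less than any power of N, which contradicts OVC
(`not_OVC_of_solvable`). For SETH the variables are split into two halves: each of the about 2^(n/2)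
assignments to a half yields the vector of the clauses that it leaves unsatisfied, and two vectors
are orthogonal iff the joint assignment satisfies the formula (`CNF.toOV_hasOrthogonalPair`,
`not_SETH_of_solvable`).

The reductions have to run on the word RAM. They are written in a small structured language whose
programs only append to the memory, with a cost semantics that compilation respects
(`Exec.reaches`). The output is then moved to address 0, everything else is cleared, and the program
for the target problem runs as if started on that output (`Problem.SolvableInTime.reduce`). -/

/-- The function with values `l[0], l[1], …`, continued by `0`. -/
def cells (l : List ℕ) : ℕ → ℕ := fun i => l.getD i 0

@[simp] theorem cells_nil (i : ℕ) : cells [] i = 0 := rfl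
@[simp] theorem cells_cons_zero (a : ℕ) (l : List ℕ) : cells (a :: l) 0 = a := rfl
@[simp] theorem cells_cons_succ (a : ℕ) (l : List ℕ) (i : ℕ) :
    cells (a :: l) (i + 1) = cells l i := rfl

theorem cells_of_length_le {l : List ℕ} {i : ℕ} (h : l.length ≤ i) : cells l i = 0 := by
  simp [cells, List.getElem?_eq_none h]

theorem cells_append_left {l l' : List ℕ} {i : ℕ} (h : i < l.length) :
    cells (l ++ l') i = cells l i := by
  simp [cells, List.getElem?_append_left h]

theorem cells_append_right (l l' : List ℕ) (i : ℕ) :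
    cells (l ++ l') (l.length + i) = cells l' i := by
  simp [cells, List.getElem?_append_right]

theorem cells_append_cons {l l' : List ℕ} {a i : ℕ} (h : i = l.length) :
    cells (l ++ a :: l') i = a := by
  simp [h, cells]

theorem update_cells_length (l : List ℕ) (a : ℕ) :
    Function.update (cells l) l.length a = cells (l ++ [a]) := by
  funext i
  rcases lt_trichotomy i l.length with h | h | h
  · rw [Function.update_of_ne h.ne, cells_append_left h]
  · subst h; simp [cells]
  · rw [Function.update_of_ne h.ne', cells_of_length_le h.le, cells_of_length_le (by simp; omega)]

theorem update_cells {l : List ℕ} {i : ℕ} (h : i < l.length) (a : ℕ) :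
    Function.update (cells l) i a = cells (l.set i a) := by
  funext j
  rcases eq_or_ne j i with rfl | hj
  · simp [cells, h]
  · rw [Function.update_of_ne hj]; simp [cells, List.getElem?_set_ne hj.symm]

/-! ### A structured language for programs that append words to their memory -/

/-- Basic commands; `emit r` appends register `r` to the memory. -/
inductive Basic
  | const (r a : ℕ)
  | op (o : WordOp) (r s t : ℕ)
  | load (r s : ℕ)
  | emit (r : ℕ)

/-- Registers, and the used part of the memory. -/
structure Store where
  reg : ℕ → ℕ
  mem : List ℕ

/-- The effect of a basic command. -/
def Basic.run (w : ℕ) (x : Store) : Basic → Store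
  | .const r a => ⟨Function.update x.reg r (a % 2 ^ w), x.mem⟩
  | .op o r s t => ⟨Function.update x.reg r (o.eval w (x.reg s) (x.reg t)), x.mem⟩
  | .load r s => ⟨Function.update x.reg r (cells x.mem (x.reg s)), x.mem⟩
  | .emit r => ⟨x.reg, x.mem ++ [x.reg r]⟩

/-- Structured programs: straight line code, composition, and the loop that is repeated while
register `r` is less than register `s`. -/
inductive Cmd
  | block (l : List Basic)
  | seq (c d : Cmd)
  | loop (r s : ℕ) (c : Cmd)

/-- `Exec w c x t y`: started in `x`, the command `c` ends in `y` after at most `t` steps. -/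
inductive Exec (w : ℕ) : Cmd → Store → ℕ → Store → Prop
  -- Two steps per basic command, since `emit` compiles to two instructions.
  | block (l : List Basic) (x : Store) : Exec w (.block l) x (2 * l.length)
      (l.foldl (Basic.run w) x)
  | seq {c d x y z t t'} : Exec w c x t y → Exec w d y t' z → Exec w (.seq c d) x (t + t') z
  -- The two steps are the test and the jump out of the loop; in `loop_step`, the test and the jump
  -- back.
  | loop_exit {r s c x} : x.reg s ≤ x.reg r → Exec w (.loop r s c) x 2 x
  | loop_step {r s c x y z t t'} : x.reg r < x.reg s → Exec w c x t y →
      Exec w (.loop r s c) y t' z → Exec w (.loop r s c) x (t + 2 + t') z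
  | mono {c x y t t'} : t ≤ t' → Exec w c x t y → Exec w c x t' y

theorem Exec.block' {w : ℕ} {l : List Basic} {x y : Store} {t : ℕ} (ht : 2 * l.length ≤ t)
    (h : l.foldl (Basic.run w) x = y) : Exec w (.block l) x t y :=
  h ▸ .mono ht (.block l x)

/-- A loop whose iterations correspond to the elements of a list. -/
theorem Exec.foreach {w : ℕ} {α : Type*} (xs : List α) (S : List α → Store) {r s t : ℕ} {c : Cmd}
    (hlt : ∀ ys x zs, xs = ys ++ x :: zs → (S ys).reg r < (S ys).reg s)
    (hend : (S xs).reg s ≤ (S xs).reg r)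
    (hbody : ∀ ys x zs, xs = ys ++ x :: zs → Exec w c (S ys) t (S (ys ++ [x]))) :
    Exec w (.loop r s c) (S []) (xs.length * (t + 2) + 2) (S xs) := by
  suffices h : ∀ zs ys, xs = ys ++ zs →
      Exec w (.loop r s c) (S ys) (zs.length * (t + 2) + 2) (S xs) from h xs [] rfl
  intro zs
  induction zs with
  | nil =>
    intro ys h
    rw [List.append_nil] at h
    subst h
    exact .mono (by simp) (.loop_exit hend)
  | cons z zs ih =>
    intro ys h
    refine .mono (le_of_eq ?_)
      (.loop_step (hlt _ _ _ h) (hbody _ _ _ h) (ih (ys ++ [z]) (by simp [h])))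
    simp only [List.length_cons]; ring

theorem Basic.length_le_run (w : ℕ) (x : Store) (b : Basic) :
    x.mem.length ≤ (b.run w x).mem.length := by
  cases b <;> simp [Basic.run]

/-- Since memory only grows, a bound on its final length bounds all intermediate lengths, so the
append pointer never wraps around modulo `2 ^ w`. -/
theorem Exec.length_le {w : ℕ} {c : Cmd} {x y : Store} {t : ℕ} (h : Exec w c x t y) :
    x.mem.length ≤ y.mem.length := by
  induction h with
  | block l x =>
    induction l generalizing x with
    | nil => exact le_rfl
    | cons b l ih => exact (b.length_le_run w x).trans (ih _)
  | seq _ _ h h' => exact h.trans h'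
  | loop_exit => exact le_rfl
  | loop_step _ _ _ h h' => exact h.trans h'
  | mono _ _ h => exact h

/-! ### Compilation -/

/-- The code of a basic command: register `0` of the machine contains the length of the used part
of the memory, register `1` contains `1`, and register `r + 2` is register `r` of the language. -/
def Basic.compile : Basic → List Instr
  | .const r a => [.const (r + 2) a]
  | .op o r s t => [.op o (r + 2) (s + 2) (t + 2)]
  | .load r s => [.load (r + 2) (s + 2)]
  | .emit r => [.store 0 (r + 2), .op .add 0 0 1]

/-- Length of the code. -/
def Cmd.size : Cmd → ℕ
  | .block l => (l.flatMap Basic.compile).length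
  | .seq c d => c.size + d.size
  | .loop _ _ c => c.size + 3

/-- The code of a structured program that is placed at line `o`. -/
def Cmd.compile : Cmd → ℕ → List Instr
  | .block l, _ => l.flatMap Basic.compile
  | .seq c d, o => c.compile o ++ d.compile (o + c.size)
  | .loop r s c, o => [.jumpLt (r + 2) (s + 2) (o + 2), .jump (o + c.size + 3)] ++
      c.compile (o + 2) ++ [.jump o]

theorem Cmd.length_compile (c : Cmd) (o : ℕ) : (c.compile o).length = c.size := by
  induction c generalizing o with
  | block l => rfl
  | seq c d hc hd => simp [compile, size, hc, hd]
  | loop r s c hc => simp [compile, size, hc]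

/-- The program `P` contains the code `l` at line `o`. -/
def Program.HasCode (P : Program) (o : ℕ) (l : List Instr) : Prop :=
  ∃ p q, P = p ++ l ++ q ∧ p.length = o

theorem Program.HasCode.left {P : Program} {o : ℕ} {l l' : List Instr}
    (h : P.HasCode o (l ++ l')) : P.HasCode o l := by
  obtain ⟨p, q, rfl, rfl⟩ := h
  exact ⟨p, l' ++ q, by simp, rfl⟩

theorem Program.HasCode.right {P : Program} {o : ℕ} {l l' : List Instr}
    (h : P.HasCode o (l ++ l')) : P.HasCode (o + l.length) l' := by
  obtain ⟨p, q, rfl, rfl⟩ := h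
  exact ⟨p ++ l, q, by simp, by simp⟩

theorem Program.HasCode.getElem? {P : Program} {o : ℕ} {i : Instr} {l : List Instr}
    (h : P.HasCode o (i :: l)) : P[o]? = some i := by
  obtain ⟨p, q, rfl, rfl⟩ := h
  simp

theorem Program.HasCode.tail {P : Program} {o : ℕ} {i : Instr} {l : List Instr}
    (h : P.HasCode o (i :: l)) : P.HasCode (o + 1) l :=
  Program.HasCode.right (l := [i]) h

/-- `P` gets from one configuration to another one in at most `t` steps. -/
def Program.Reaches (P : Program) (w : ℕ) (c : Config) (t : ℕ) (c' : Config) : Prop :=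
  ∃ t' ≤ t, (P.step w)^[t'] c = c'

theorem Program.Reaches.refl (P : Program) (w : ℕ) (c : Config) : P.Reaches w c 0 c :=
  ⟨0, le_rfl, rfl⟩

theorem Program.Reaches.trans {P : Program} {w : ℕ} {c₁ c₂ c₃ : Config} {t t' : ℕ}
    (h : P.Reaches w c₁ t c₂) (h' : P.Reaches w c₂ t' c₃) : P.Reaches w c₁ (t + t') c₃ := by
  obtain ⟨s, hs, rfl⟩ := h
  obtain ⟨s', hs', rfl⟩ := h'
  exact ⟨s' + s, by omega, Function.iterate_add_apply _ _ _ _⟩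

theorem Program.Reaches.congr {P : Program} {w : ℕ} {c c' c'' : Config} {t t' : ℕ}
    (h : P.Reaches w c t c') (ht : t ≤ t') (hc : c' = c'') : P.Reaches w c t' c'' :=
  hc ▸ h.imp fun _ hs => ⟨hs.1.trans ht, hs.2⟩

theorem Program.reaches_one {P : Program} {w : ℕ} {c : Config} {i : Instr} (h : P[c.pc]? = some i) :
    P.Reaches w c 1 (i.exec w c) :=
  ⟨1, le_rfl, by simp [Program.step, h]⟩

theorem Program.HasCode.reaches_one {P : Program} {w o : ℕ} {i : Instr} {l : List Instr}
    (h : P.HasCode o (i :: l)) (r m : ℕ → ℕ) : P.Reaches w ⟨o, r, m⟩ 1 (i.exec w ⟨o, r, m⟩) :=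
  Program.reaches_one h.getElem?

/-- The machine registers that represent a store.  Register `0` has the given value, by default the
length of the used part of the memory. -/
def Store.machineReg (p : Option ℕ) (x : Store) : ℕ → ℕ
  | 0 => p.getD x.mem.length
  | 1 => 1
  | r + 2 => x.reg r

/-- The configuration at line `o` that represents a store. -/
def Store.config (p : Option ℕ) (x : Store) (o : ℕ) : Config := ⟨o, x.machineReg p, cells x.mem⟩

theorem Store.machineReg_update (p : Option ℕ) (x : Store) (r a : ℕ) :
    Function.update (x.machineReg p) (r + 2) a =
      Store.machineReg p ⟨Function.update x.reg r a, x.mem⟩ := by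
  funext i
  match i with
  | 0 => rfl
  | 1 => rfl
  | i + 2 => simp [Store.machineReg, Function.update_apply]

/-- The command does not append to the memory. -/
def Basic.EmitFree : Basic → Prop
  | .emit _ => False
  | _ => True

/-- The command does not append to the memory. -/
def Cmd.EmitFree : Cmd → Prop
  | .block l => ∀ b ∈ l, b.EmitFree
  | .seq c d => c.EmitFree ∧ d.EmitFree
  | .loop _ _ c => c.EmitFree

/-- Only `emit` uses machine register `0`. Code without it is simulated correctly whatever that
register contains, which is needed as long as the input length is unknown. -/
theorem Basic.reaches {P : Program} {w o : ℕ} {x : Store} {p : Option ℕ} (b : Basic)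
    (hp : p = none ∨ b.EmitFree) (h : P.HasCode o b.compile)
    (hw : (b.run w x).mem.length < 2 ^ w) :
    P.Reaches w (x.config p o) 2 ((b.run w x).config p (o + b.compile.length)) := by
  cases b with
  | emit r =>
    obtain rfl : p = none := hp.resolve_right id
    refine ((h.reaches_one (x.machineReg none) (cells x.mem)).trans
      (h.tail.reaches_one _ _)).congr le_rfl ?_
    simp only [Basic.run, List.length_append, List.length_singleton] at hw
    simp only [Instr.exec, WordOp.eval, Store.config, Basic.run, Basic.compile]
    congr 1
    · funext i
      match i with
      | 0 => simp [Store.machineReg, Nat.mod_eq_of_lt hw]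
      | 1 => rfl
      | i + 2 => rfl
    · exact update_cells_length _ _
  | const r a =>
    refine (h.reaches_one (x.machineReg p) (cells x.mem)).congr one_le_two ?_
    simp only [Instr.exec, Store.machineReg_update]; rfl
  | op _ r s t =>
    refine (h.reaches_one (x.machineReg p) (cells x.mem)).congr one_le_two ?_
    simp only [Instr.exec, Store.machineReg_update]; rfl
  | load r s =>
    refine (h.reaches_one (x.machineReg p) (cells x.mem)).congr one_le_two ?_
    simp only [Instr.exec, Store.machineReg_update]; rfl

/-- Compilation is correct. -/
theorem Exec.reaches {P : Program} {w : ℕ} {p : Option ℕ} {c : Cmd} {x y : Store} {t : ℕ}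
    (h : Exec w c x t y) (hp : p = none ∨ c.EmitFree) (hw : y.mem.length < 2 ^ w) {o : ℕ}
    (hP : P.HasCode o (c.compile o)) : P.Reaches w (x.config p o) t (y.config p (o + c.size)) := by
  induction h generalizing o with
  | block l x =>
    simp only [Cmd.compile, Cmd.size] at hP ⊢
    induction l generalizing x o with
    | nil => exact .refl _ _ _
    | cons b l ih =>
      rw [List.flatMap_cons] at hP
      have h1 := (Exec.block (w := w) l (b.run w x)).length_le
      have := (b.reaches (hp.imp_right fun h => h b (by simp)) hP.left (h1.trans_lt hw)).trans
        (ih _ (hp.imp_right fun h b hb => h b (by simp [hb])) hw hP.right)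
      exact this.congr (by simp only [List.length_cons]; omega) (by simp [add_assoc])
  | seq h1 h2 ih1 ih2 =>
    simp only [Cmd.compile, Cmd.size] at hP ⊢
    have h3 := hP.right
    rw [Cmd.length_compile] at h3
    rw [← add_assoc]
    exact (ih1 (hp.imp_right And.left) (h2.length_le.trans_lt hw) hP.left).trans
      (ih2 (hp.imp_right And.right) hw h3)
  | loop_exit h =>
    rename_i r s c x
    simp only [Cmd.compile, Cmd.size, List.append_assoc, List.cons_append] at hP ⊢
    have h1 := hP.reaches_one (w := w) (x.machineReg p) (cells x.mem)
    simp only [Instr.exec, Store.machineReg, not_lt.2 h, if_false] at h1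
    exact h1.trans (hP.tail.reaches_one _ _)
  | loop_step h h1 h2 ih1 ih2 =>
    rename_i r s c x y z t t'
    have hP' := hP
    simp only [Cmd.compile, List.cons_append, List.nil_append] at hP
    have e1 := hP.reaches_one (w := w) (x.machineReg p) (cells x.mem)
    simp only [Instr.exec, Store.machineReg, h, if_true] at e1
    have e2 := ih1 hp (h2.length_le.trans_lt hw) hP.tail.tail.left
    have e3 := hP.tail.tail.right
    rw [Cmd.length_compile] at e3
    refine (((e1.trans e2).trans (e3.reaches_one _ _)).trans (ih2 hp hw hP')).congr (by omega) rfl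
  | mono ht _ ih => exact (ih hp hw hP).congr ht rfl

/-! ### Reductions -/

/-- The instruction with all jumps shifted by `o`. -/
def Instr.shift (o : ℕ) : Instr → Instr
  | .jump l => .jump (o + l)
  | .jumpZero r l => .jumpZero r (o + l)
  | .jumpLt r s l => .jumpLt r s (o + l)
  | i => i

theorem Instr.exec_shift (w o : ℕ) (c : Config) (i : Instr) :
    (i.shift o).exec w ⟨o + c.pc, c.reg, c.mem⟩ =
      ⟨o + (i.exec w c).pc, (i.exec w c).reg, (i.exec w c).mem⟩ := by
  cases i <;> simp only [shift, exec, add_assoc, Config.mk.injEq, and_self, and_true] <;>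
    split_ifs <;> rfl

/-- Jumps are shifted along with the code, and a line beyond the end of `Q` lies beyond the end of
the whole program, so the two runs stay in lockstep even after halting. -/
theorem Program.iterate_step_append (P : List Instr) (Q : Program) (w t : ℕ) (c : Config) :
    (Program.step (P ++ Q.map (Instr.shift P.length)) w)^[t] ⟨P.length + c.pc, c.reg, c.mem⟩ =
      ⟨P.length + ((Q.step w)^[t] c).pc, ((Q.step w)^[t] c).reg, ((Q.step w)^[t] c).mem⟩ := by
  induction t generalizing c with
  | zero => rfl
  | succ t ih =>
    rw [Function.iterate_succ_apply, Function.iterate_succ_apply, ← ih]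
    congr 1
    unfold Program.step
    rw [List.getElem?_append_right (by simp), List.getElem?_map, Nat.add_sub_cancel_left]
    cases h : Q[c.pc]? with
    | none => rfl
    | some i => exact i.exec_shift w _ c

/-- A preamble must end in exactly the initial configuration of `Q`: all registers zero, and no
memory content besides its input. -/
theorem Program.HaltsWith.iterate {P : Program} {w t : ℕ} {x : List ℕ} {mem : ℕ → ℕ}
    {Q : Program} {P' : List Instr} (hQ : Q.HaltsWith w x t mem)
    (hP : P = P' ++ Q.map (Instr.shift P'.length)) {y : List ℕ} {t' : ℕ}
    (h : P.Reaches w (Config.init y) t' ⟨P'.length, fun _ => 0, cells x⟩) :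
    ∃ s ≤ t' + t, P.HaltsWith w y s mem := by
  obtain ⟨s, hs, h⟩ := h
  refine ⟨t + s, by omega, ?_⟩
  have := Program.iterate_step_append P' Q w t (Config.init x)
  rw [← hP] at this
  rw [Program.HaltsWith, Function.iterate_add_apply, h]
  refine ⟨?_, ?_⟩
  · refine le_trans (le_of_eq ?_) (le_of_le_of_eq (Nat.add_le_add_left hQ.1 P'.length)
      (congrArg Config.pc this).symm)
    simp [hP]
  · exact (congrArg Config.mem this).trans hQ.2

/-! ### Moving the output to address 0 and clearing the rest -/

/-- Code that moves a part of the memory to the front, and cleans up: the part starts at the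
address in register `2` and ends before the address in register `0`; register `1` contains `1`. -/
def moveCode (o : ℕ) : List Instr :=
  [.const 3 0,
   .jumpLt 2 0 (o + 3),
   .jump (o + 8),
   .load 4 2,
   .store 3 4,
   .op .add 2 2 1,
   .op .add 3 3 1,
   .jump (o + 1),
   .const 4 0,
   .jumpLt 3 0 (o + 11),
   .jump (o + 14),
   .store 3 4,
   .op .add 3 3 1,
   .jump (o + 9)] ++ (List.range 20).map fun r => .const r 0

theorem reaches_clear {P : Program} {w o : ℕ} (n : ℕ) {r m : ℕ → ℕ} (l : List ℕ)
    (hP : P.HasCode o (l.map fun r => .const r 0)) (hr : ∀ i, i ∉ l → r i = 0)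
    (hn : l.length = n) : P.Reaches w ⟨o, r, m⟩ n ⟨o + n, fun _ => 0, m⟩ := by
  induction l generalizing o r n with
  | nil =>
    obtain rfl : r = fun _ => 0 := funext fun i => hr i (by simp)
    exact ⟨0, by omega, by simp [← hn]⟩
  | cons a l ih =>
    rw [List.map_cons] at hP
    obtain rfl : l.length + 1 = n := hn
    refine ((hP.reaches_one r m).trans (ih l.length hP.tail ?_ rfl)).congr (by omega) ?_
    · intro i hi
      by_cases h : i = a
      · simp [h]
      · simp only [Function.update_of_ne h]; exact hr i (by simp [h, hi])
    · simp only [Config.mk.injEq, and_self, and_true]; omega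

theorem Program.HasCode.getElem?_add {P : Program} {o : ℕ} {l : List Instr} (h : P.HasCode o l)
    {k : ℕ} {i : Instr} (hi : l[k]? = some i) : P[o + k]? = some i := by
  obtain ⟨p, q, rfl, rfl⟩ := h
  have hk : k < l.length := by
    by_contra hk
    simp [List.getElem?_eq_none (not_lt.1 hk)] at hi
  rw [List.append_assoc, List.getElem?_append_right (by omega), Nat.add_sub_cancel_left,
    List.getElem?_append_left hk, hi]

theorem Program.HasCode.reaches_one_add {P : Program} {w o : ℕ} {l : List Instr}
    (h : P.HasCode o l) {k : ℕ} {i : Instr} (hi : l[k]? = some i) (r m : ℕ → ℕ) :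
    P.Reaches w ⟨o + k, r, m⟩ 1 (i.exec w ⟨o + k, r, m⟩) :=
  Program.reaches_one (h.getElem?_add hi)

/-- Source and destination may overlap, but copying upwards never destroys unread cells: after `i`
copies the cells below `i` hold `y` and those from `i` on are still original. -/
theorem reaches_copy {P : Program} {w o : ℕ} (hP : P.HasCode o (moveCode o)) (x y : List ℕ)
    (hw : x.length + y.length < 2 ^ w) (n : ℕ) : ∀ (i : ℕ) (r m : ℕ → ℕ), i + n = y.length →
    r 0 = x.length + y.length → r 1 = 1 → r 2 = x.length + i → r 3 = i → (∀ j, 20 ≤ j → r j = 0) →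
    (∀ j < i, m j = cells y j) → (∀ j, i ≤ j → m j = cells (x ++ y) j) →
    ∃ r' m', P.Reaches w ⟨o + 1, r, m⟩ (6 * n + 2) ⟨o + 8, r', m'⟩ ∧ r' 0 = x.length + y.length ∧
      r' 1 = 1 ∧ r' 3 = y.length ∧ (∀ j, 20 ≤ j → r' j = 0) ∧ (∀ j < y.length, m' j = cells y j) ∧
      (∀ j, y.length ≤ j → m' j = cells (x ++ y) j) := by
  induction n with
  | zero =>
    intro i r m hi h0 h1 h2 h3 h4 h5 h6
    have e1 := hP.reaches_one_add (w := w) (k := 1) rfl r m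
    have e2 := hP.reaches_one_add (w := w) (k := 2) rfl r m
    simp only [Instr.exec, h0, h2, show ¬ x.length + i < x.length + y.length by omega,
      if_false] at e1 e2
    obtain rfl : i = y.length := by omega
    exact ⟨r, m, e1.trans e2, h0, h1, h3, h4, h5, h6⟩
  | succ n ih =>
    intro i r m hi h0 h1 h2 h3 h4 h5 h6
    have e1 := hP.reaches_one_add (w := w) (k := 1) rfl r m
    have e2 := hP.reaches_one_add (w := w) (k := 3) rfl r m
    simp only [Instr.exec, h0, h2, show x.length + i < x.length + y.length by omega,
      if_true] at e1 e2
    have e3 := hP.reaches_one_add (w := w) (k := 4) rfl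
      (Function.update r 4 (m (x.length + i))) m
    have e4 := hP.reaches_one_add (w := w) (k := 5) rfl
      (Function.update r 4 (m (x.length + i))) (Function.update m i (m (x.length + i)))
    simp only [Instr.exec, Function.update_self, Function.update_of_ne (show (3 : ℕ) ≠ 4 by simp),
      Function.update_of_ne (show (2 : ℕ) ≠ 4 by simp),
      Function.update_of_ne (show (1 : ℕ) ≠ 4 by simp), WordOp.eval, h1, h2, h3,
      Nat.mod_eq_of_lt (show x.length + i + 1 < 2 ^ w by omega)] at e3 e4
    set r1 := Function.update (Function.update r 4 (m (x.length + i))) 2 (x.length + i + 1) with hr1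
    have e5 := hP.reaches_one_add (w := w) (k := 6) rfl r1
      (Function.update m i (m (x.length + i)))
    simp only [Instr.exec, WordOp.eval, show r1 3 = i by simp [hr1, h3],
      show r1 1 = 1 by simp [hr1, h1], Nat.mod_eq_of_lt (show i + 1 < 2 ^ w by omega)] at e5
    have e6 := hP.reaches_one_add (w := w) (k := 7) rfl (Function.update r1 3 (i + 1))
      (Function.update m i (m (x.length + i)))
    obtain ⟨r', m', hr, h⟩ := ih (i + 1) (Function.update r1 3 (i + 1))
      (Function.update m i (m (x.length + i))) (by omega) (by simp [hr1, h0]) (by simp [hr1, h1])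
      (by simp [hr1]; omega) (by simp)
      (fun j hj => by
        simp only [hr1, Function.update_of_ne (show j ≠ 2 by omega),
          Function.update_of_ne (show j ≠ 3 by omega), Function.update_of_ne (show j ≠ 4 by omega)]
        exact h4 j hj)
      (fun j hj => by
        rcases eq_or_ne j i with rfl | hj'
        · rw [Function.update_self, h6 _ (by omega), cells_append_right]
        · rw [Function.update_of_ne hj']; exact h5 _ (by omega))
      (fun j hj => by rw [Function.update_of_ne (by omega)]; exact h6 _ (by omega))
    exact ⟨r', m', ((((((e1.trans e2).trans e3).trans e4).trans e5).trans e6).trans hr).congr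
      (by omega) rfl, h⟩

theorem reaches_zero {P : Program} {w o : ℕ} (hP : P.HasCode o (moveCode o)) (y : List ℕ) (a : ℕ)
    (hw : a < 2 ^ w) (n : ℕ) : ∀ (i : ℕ) (r m : ℕ → ℕ), i + n = a → y.length ≤ i →
    r 0 = a → r 1 = 1 → r 3 = i → r 4 = 0 → (∀ j, 20 ≤ j → r j = 0) →
    (∀ j, j < i ∨ a ≤ j → m j = cells y j) →
    ∃ r', P.Reaches w ⟨o + 9, r, m⟩ (4 * n + 2) ⟨o + 14, r', cells y⟩ ∧
      (∀ j, 20 ≤ j → r' j = 0) := by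
  induction n with
  | zero =>
    intro i r m hi hy h0 h1 h3 h4 h5 h6
    have e1 := hP.reaches_one_add (w := w) (k := 9) rfl r m
    have e2 := hP.reaches_one_add (w := w) (k := 10) rfl r m
    obtain rfl : i = a := by omega
    simp only [Instr.exec, h0, h3, lt_irrefl, if_false] at e1 e2
    obtain rfl : m = cells y := funext fun j => h6 j (lt_or_ge _ _)
    exact ⟨r, e1.trans e2, h5⟩
  | succ n ih =>
    intro i r m hi hy h0 h1 h3 h4 h5 h6
    have e1 := hP.reaches_one_add (w := w) (k := 9) rfl r m
    have e2 := hP.reaches_one_add (w := w) (k := 11) rfl r m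
    have e3 := hP.reaches_one_add (w := w) (k := 12) rfl r (Function.update m i 0)
    simp only [Instr.exec, h0, h1, h3, h4, show i < a by omega, if_true, WordOp.eval,
      Nat.mod_eq_of_lt (show i + 1 < 2 ^ w by omega)] at e1 e2 e3
    have e4 := hP.reaches_one_add (w := w) (k := 13) rfl (Function.update r 3 (i + 1))
      (Function.update m i 0)
    obtain ⟨r', hr, h⟩ := ih (i + 1) (Function.update r 3 (i + 1))
      (Function.update m i 0) (by omega) (by omega) (by simp [h0]) (by simp [h1])
      (by simp) (by simp [h4])
      (fun j hj => by rw [Function.update_of_ne (show j ≠ 3 by omega)]; exact h5 j hj)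
      (fun j hj => by
        rcases eq_or_ne j i with rfl | hj'
        · rw [Function.update_self, cells_of_length_le hy]
        · rw [Function.update_of_ne hj']; exact h6 _ (by omega))
    exact ⟨r', ((((e1.trans e2).trans e3).trans e4).trans hr).congr (by omega) rfl, h⟩

/-- Six steps per copied cell, four per cleared cell, and 20 for the registers; the cells to clear
are the leftovers between `y.length` and `x.length + y.length`. -/
theorem reaches_move {P : Program} {w o : ℕ} (hP : P.HasCode o (moveCode o)) (x y : List ℕ)
    (hw : x.length + y.length < 2 ^ w) (r : ℕ → ℕ) (h0 : r 0 = x.length + y.length) (h1 : r 1 = 1)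
    (h2 : r 2 = x.length) (hr : ∀ j, 20 ≤ j → r j = 0) :
    P.Reaches w ⟨o, r, cells (x ++ y)⟩ (6 * (x.length + y.length) + 26)
      ⟨o + (moveCode o).length, fun _ => 0, cells y⟩ := by
  have e1 := hP.reaches_one_add (w := w) (k := 0) rfl r (cells (x ++ y))
  simp only [Instr.exec, Nat.zero_mod, add_zero] at e1
  obtain ⟨r', m', e2, h0', h1', h3', hr', hm, hm'⟩ := reaches_copy hP x y hw y.length 0
    (Function.update r 3 0) (cells (x ++ y)) (by omega) (by simp [h0]) (by simp [h1])
    (by simp [h2]) (by simp)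
    (fun j hj => by rw [Function.update_of_ne (show j ≠ 3 by omega)]; exact hr j hj)
    (by simp) (fun _ _ => rfl)
  have e3 := hP.reaches_one_add (w := w) (k := 8) rfl r' m'
  simp only [Instr.exec, Nat.zero_mod] at e3
  obtain ⟨r'', e4, hr''⟩ := reaches_zero hP y _ hw x.length y.length (Function.update r' 4 0) m'
    (add_comm _ _) le_rfl (by simp [h0']) (by simp [h1']) (by simp [h3']) (by simp)
    (fun j hj => by rw [Function.update_of_ne (show j ≠ 4 by omega)]; exact hr' j hj)
    (fun j hj => hj.elim (hm j) fun hj => by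
      rw [hm' _ (by omega), cells_of_length_le (by simp; omega), cells_of_length_le (by omega)])
  have e5 := reaches_clear (w := w) (o := o + 14) (r := r'') (m := cells y) 20 (List.range 20)
    hP.right (fun j hj => hr'' j (by simpa using hj)) (by simp)
  exact ((((e1.trans e2).trans e3).trans e4).trans e5).congr (by omega) rfl

/-! ### Composing a reduction with a program -/

/-- A machine program that starts with a structured program: `c` computes the length of the input,
`d` appends the input for `Q` to the memory. -/
def glue (c d : Cmd) (Q : Program) : Program :=
  let P₁ : List Instr := Instr.const 1 1 :: c.compile 1
  -- The `or` of a register with itself is a copy: the input length, in register `0` of the language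
  -- and `2` of the machine, becomes the append pointer.
  let P₂ : List Instr := P₁ ++ Instr.op .or 0 2 2 :: d.compile (P₁.length + 1)
  let P₃ : List Instr := P₂ ++ moveCode P₂.length
  P₃ ++ Q.map (Instr.shift P₃.length)

/-- The commands `c` and `d` transform the input `x` into the input `y` in time `t`. -/
def Transforms (w : ℕ) (c d : Cmd) (x y : List ℕ) (t : ℕ) : Prop :=
  -- Register `0` keeps the input length because `y` starts at that address. The bound 18 leaves
  -- only machine registers below 20 nonzero, which are those that `moveCode` clears.
  ∃ (t₁ t₂ : ℕ) (R R' : List ℕ), t₁ + t₂ ≤ t ∧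
    Exec w c ⟨cells [], x⟩ t₁ ⟨cells (x.length :: R), x⟩ ∧
    Exec w d ⟨cells (x.length :: R), x⟩ t₂ ⟨cells (x.length :: R'), x ++ y⟩ ∧ R'.length < 18

theorem glue_haltsWith {w : ℕ} {c d : Cmd} {Q : Program} {x y : List ℕ} {t t' : ℕ} {mem : ℕ → ℕ}
    (hc : c.EmitFree) (h : Transforms w c d x y t) (hw : x.length + y.length < 2 ^ w)
    (hw' : 1 < 2 ^ w)
    (hQ : Q.HaltsWith w y t' mem) :
    ∃ s ≤ t + 6 * (x.length + y.length) + 28 + t', (glue c d Q).HaltsWith w x s mem := by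
  obtain ⟨t₁, t₂, R, R', ht, hE, hE', hR⟩ := h
  set P₁ : List Instr := Instr.const 1 1 :: c.compile 1 with hP₁
  set P₂ : List Instr := P₁ ++ Instr.op .or 0 2 2 :: d.compile (P₁.length + 1) with hP₂
  set P₃ : List Instr := P₂ ++ moveCode P₂.length with hP₃
  have hP : glue c d Q = P₃ ++ Q.map (Instr.shift P₃.length) := rfl
  have k₃ : (glue c d Q).HasCode 0 P₃ := ⟨[], _, hP, rfl⟩
  have k₂ := k₃.left
  have k₁ := k₂.left
  have e0 := k₁.reaches_one (w := w) (fun _ => 0) (cells x)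
  have e1 := hE.reaches (p := some 0) (Or.inr hc) (by simp only; omega) k₁.tail
  have k₁' := k₂.right
  rw [zero_add] at k₁'
  have e2 := k₁'.reaches_one (w := w) (Store.machineReg (some 0) ⟨cells (x.length :: R), x⟩)
    (cells x)
  have e3 := hE'.reaches (p := none) (Or.inl rfl) (by simpa using hw) k₁'.tail
  have k₂' := k₃.right
  rw [zero_add] at k₂'
  have e4 := reaches_move k₂' x y hw (Store.machineReg none ⟨cells (x.length :: R'), x ++ y⟩)
    (by simp [Store.machineReg]) rfl rfl (fun j hj => by
      obtain ⟨j, rfl⟩ := Nat.exists_eq_add_of_le' (show 2 ≤ j by omega)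
      exact cells_of_length_le (by simp; omega))
  have l₁ : P₁.length = 1 + c.size := by simp [hP₁, Cmd.length_compile]; omega
  have l₂ : P₂.length = P₁.length + 1 + d.size := by simp [hP₂, Cmd.length_compile]; omega
  have l₃ : P₃.length = P₂.length + (moveCode P₂.length).length := by simp [hP₃]
  have e01 : Instr.exec w ⟨0, fun _ => 0, cells x⟩ (.const 1 1) =
      Store.config (some 0) ⟨cells [], x⟩ (0 + 1) := by
    simp only [Instr.exec, Store.config, Config.mk.injEq, true_and, and_true]
    funext j
    match j with
    | 0 => rfl
    | 1 => simp [Store.machineReg, Nat.mod_eq_of_lt hw']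
    | j + 2 => rfl
  have e23 : Instr.exec w ⟨P₁.length, Store.machineReg (some 0) ⟨cells (x.length :: R), x⟩, cells x⟩
      (.op .or 0 2 2) = Store.config none ⟨cells (x.length :: R), x⟩ (P₁.length + 1) := by
    simp only [Instr.exec, Store.config, Config.mk.injEq, true_and, and_true]
    funext j
    match j with
    | 0 => simp [Store.machineReg, WordOp.eval, Nat.mod_eq_of_lt (show x.length < 2 ^ w by omega)]
    | 1 => rfl
    | j + 2 => rfl
  rw [e01] at e0
  rw [e23] at e2
  have e := e0.trans e1
  rw [show 0 + 1 + c.size = P₁.length by omega] at e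
  have e' := (e.trans e2).trans e3
  rw [← l₂] at e'
  have e'' := e'.trans e4
  rw [← l₃] at e''
  obtain ⟨s, hs, h⟩ := hQ.iterate hP e''
  exact ⟨s, by omega, h⟩

/-- For large `w` the word length condition holds, and then `T x` bounds a number of steps. -/
theorem Problem.SolvableInTime.nonneg {Q : Problem} {T : Q.Inst → ℝ} (h : Q.SolvableInTime T)
    (x : Q.Inst) : 0 ≤ T x := by
  obtain ⟨P, c, h⟩ := h
  obtain ⟨w₁, h₁⟩ := pow_unbounded_of_one_lt ((2 + Q.length x + T x : ℝ) ^ c) one_lt_two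
  obtain ⟨b, hb⟩ : ∃ b, ∀ a ∈ Q.encode x, a ≤ b :=
    ⟨(Q.encode x).sum, fun a ha => List.single_le_sum (by simp) a ha⟩
  obtain ⟨w₂, h₂⟩ := pow_unbounded_of_one_lt b one_lt_two
  obtain ⟨t, mem, ht, -⟩ := h x (max w₁ w₂)
    (h₁.le.trans (pow_le_pow_right₀ one_le_two (le_max_left _ _)))
    (fun a ha => (hb a ha).trans_lt (h₂.trans_le (pow_le_pow_right₀ one_le_two (le_max_right _ _))))
  exact t.cast_nonneg.trans ht

/-- By `htime` the bound `TA x` dominates both lengths and `TB (f x)`. Hence a word length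
sufficient for `A` with exponent `max (b + 1) e` suffices for addressing input and output, for the
transformation (exponent `b`) and for the program of `B` (exponent `e`). -/
theorem Problem.SolvableInTime.reduce {A B : Problem} {TA : A.Inst → ℝ} {TB : B.Inst → ℝ}
    (hB : B.SolvableInTime TB) (f : A.Inst → B.Inst) (c d : Cmd) (hc : c.EmitFree)
    (hcorrect : ∀ x mem, B.Correct (f x) mem → A.Correct x mem) (b : ℕ) (t : A.Inst → ℕ)
    (htransforms : ∀ x w, ((2 + A.length x + TA x : ℝ) ^ b ≤ 2 ^ w) →
      (∀ a ∈ A.encode x, a < 2 ^ w) → A.length x + B.length (f x) + 1 < 2 ^ w →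
      Transforms w c d (A.encode x) (B.encode (f x)) (t x) ∧ ∀ a ∈ B.encode (f x), a < 2 ^ w)
    (htime : ∀ x, (t x : ℝ) + 6 * (A.length x + B.length (f x)) + 28 + TB (f x) ≤ TA x) :
    A.SolvableInTime TA := by
  have hB0 := hB.nonneg
  obtain ⟨Q, e, hQ⟩ := hB
  refine ⟨glue c d Q, max (b + 1) e, fun x w hw hx => ?_⟩
  have h0 := hB0 (f x)
  have ht := htime x
  have h1 : (1 : ℝ) ≤ 2 + A.length x + TA x := by
    have : (0 : ℝ) ≤ t x + 6 * (A.length x + B.length (f x)) + A.length x := by positivity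
    linarith
  have hle (i : ℕ) (hi : i ≤ max (b + 1) e) : (2 + A.length x + TA x : ℝ) ^ i ≤ 2 ^ w :=
    (pow_le_pow_right₀ h1 hi).trans hw
  have hlen : A.length x + B.length (f x) + 1 < 2 ^ w := by
    have h2 := hle 1 (by omega)
    rw [pow_one] at h2
    have : ((A.length x + B.length (f x) + 1 : ℕ) : ℝ) < ((2 ^ w : ℕ) : ℝ) := by
      push_cast
      refine lt_of_lt_of_le ?_ h2
      have : (0 : ℝ) ≤ t x + 5 * (A.length x + B.length (f x)) + A.length x := by positivity
      linarith
    exact_mod_cast this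
  have hb := htransforms x w (hle b (by omega)) hx hlen
  obtain ⟨s, mem, hs, hh, hC⟩ := hQ (f x) w (le_trans (pow_le_pow_left₀ (by positivity) (by
      have : (0 : ℝ) ≤ t x + 5 * B.length (f x) + 7 * A.length x + 28 := by positivity
      linarith) e) (hle e (by omega))) hb.2
  obtain ⟨s', hs', hh'⟩ := glue_haltsWith hc hb.1
    (show A.length x + B.length (f x) < 2 ^ w by omega) (by omega) hh
  refine ⟨s', mem, ?_, hh', hcorrect x mem hC⟩
  have : (s' : ℝ) ≤ t x + 6 * (A.length x + B.length (f x)) + 28 + s := by exact_mod_cast hs'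
  linarith

/-! ### From orthogonal vectors to disjunctive safety: the program -/

/-- The entries `base + 3 j + k (1 - b)` for the bits `b` of a vector. -/
def rowCode (base k : ℕ) (bs : List Bool) : List ℕ :=
  -- Coordinate `j` owns the numbers `base + 3 j`, `base + 3 j + 1` and `base + 3 j + 2`. A row with
  -- `k = 1` and one with `k = 2` share an entry at `j` iff both bits are 1. Each bit yields one
  -- entry whatever its value, so the length of a row is known before its bits are read.
  bs.mapIdx fun j b => base + 3 * j + k * (!b).toNat

@[simp] theorem length_rowCode (base k : ℕ) (bs : List Bool) :
    (rowCode base k bs).length = bs.length := by simp [rowCode]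

theorem rowCode_concat (base k : ℕ) (bs : List Bool) (b : Bool) :
    rowCode base k (bs ++ [b]) = rowCode base k bs ++ [base + 3 * bs.length + k * (!b).toNat] := by
  simp [rowCode, List.mapIdx_append]

/-- The registers of the program. -/
def ovRegs (d N₁ N₂ p i j : ℕ) : List ℕ :=
  -- Register 1 is the read pointer, 5 and 6 are the outer and inner loop counters, 7 is scratch
  -- space, and 11 contains the number of vertices; 8, 9, 14 and 15 contain constants.
  [(N₁ + N₂) * d + 3, p, d, N₁, N₂, i, j, 0, 1, 3, N₁ + 2, N₁ + 2 + 3 * d, N₁ + 1, d + 1, 0, 2]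

/-- Program for `rowCode`; register `s` contains `k`. -/
def rowCmd (s : ℕ) : Cmd :=
  .loop 6 11 (.block [.load 7 1, .op .add 1 1 8, .op .xor 7 7 8, .op .mul 7 7 s, .op .add 7 6 7,
    .emit 7, .op .add 6 6 9, .const 7 0])

theorem toNat_xor_one (b : Bool) : b.toNat ^^^ 1 = (!b).toNat := by cases b <;> rfl

/-- The input bits stay in place while output is appended behind them. Register 6 is both the loop
counter and the vertex number `N₁ + 2 + 3 j`; resetting register 7 restores the form `ovRegs`. -/
theorem rowCmd_exec {w d N₁ N₂ p i s k : ℕ} (hs : s = 8 ∧ k = 1 ∨ s = 15 ∧ k = 2)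
    (hn : N₁ + 2 + 3 * d < 2 ^ w) (bs : List Bool) (hbs : bs.length = d) (M pre post : List ℕ)
    (hM : M = pre ++ (bs.map Bool.toNat ++ post)) (hp : p = pre.length) (hMw : M.length < 2 ^ w) :
    Exec w (rowCmd s) ⟨cells (ovRegs d N₁ N₂ p i (N₁ + 2)), M⟩ (d * 18 + 2)
      ⟨cells (ovRegs d N₁ N₂ (p + d) i (N₁ + 2 + 3 * d)), M ++ rowCode (N₁ + 2) k bs⟩ := by
  have key := Exec.foreach (w := w) (t := 16) (r := 6) (s := 11) bs (fun ys =>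
    ⟨cells (ovRegs d N₁ N₂ (p + ys.length) i (N₁ + 2 + 3 * ys.length)),
      M ++ rowCode (N₁ + 2) k ys⟩)
    (c := .block [.load 7 1, .op .add 1 1 8, .op .xor 7 7 8, .op .mul 7 7 s, .op .add 7 6 7,
    .emit 7, .op .add 6 6 9, .const 7 0]) ?_ ?_ ?_
  · rw [hbs] at key
    simpa [rowCode, rowCmd] using key
  · intro ys x zs h
    have := congrArg List.length h
    simp at this
    simp [ovRegs]
    omega
  · simp [ovRegs, hbs]
  · intro ys x zs h
    have hl := congrArg List.length h
    simp at hl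
    have hload : cells (M ++ rowCode (N₁ + 2) k ys) (p + ys.length) = x.toNat := by
      rw [hM, h]
      have : pre ++ ((ys ++ x :: zs).map Bool.toNat ++ post) ++ rowCode (N₁ + 2) k ys =
        (pre ++ ys.map Bool.toNat) ++ x.toNat :: (zs.map Bool.toNat ++ post ++
          rowCode (N₁ + 2) k ys) := by
        simp
      rw [this]
      exact cells_append_cons (by simp [hp])
    have hMl : M.length = p + d + post.length := by
      rw [hM]; simp [hp, hbs]; omega
    have hx := (!x).toNat_le
    refine .block' (by simp) ?_
    rcases hs with ⟨rfl, rfl⟩ | ⟨rfl, rfl⟩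
    · simp (disch := first | omega | exact of_decide_eq_true rfl) [Basic.run, WordOp.eval, ovRegs,
      update_cells, Nat.mod_eq_of_lt, hload, toNat_xor_one, rowCode_concat]
      refine congrArg cells ?_; simp; omega
    · simp (disch := first | omega | exact of_decide_eq_true rfl) [Basic.run, WordOp.eval, ovRegs,
      update_cells, Nat.mod_eq_of_lt, hload, toNat_xor_one, rowCode_concat]
      exact ⟨congrArg cells (by simp; omega), mul_comm _ _⟩

/-- Program that computes the length of the input. -/
def ovLength : Cmd :=
  .block [.const 8 1, .const 15 2, .const 9 3, .load 2 14, .load 3 8, .load 4 15, .op .add 0 3 4,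
    .op .mul 0 0 2, .op .add 0 0 9]

theorem ovLength_exec {w d N₁ N₂ : ℕ} (bits : List ℕ) (hw : (N₁ + N₂) * d + 3 < 2 ^ w)
    (hN : N₁ + N₂ < 2 ^ w) :
    Exec w ovLength ⟨cells [], d :: N₁ :: N₂ :: bits⟩ 18
      ⟨cells [(N₁ + N₂) * d + 3, 0, d, N₁, N₂, 0, 0, 0, 1, 3, 0, 0, 0, 0, 0, 2],
        d :: N₁ :: N₂ :: bits⟩ := by
  -- `update_cells` needs positions inside the list, so the empty register file is padded with
  -- zeros.
  have h0 : cells [] = cells [0, 0, 0, 0, 0, 0, 0, 0, 0, 0, 0, 0, 0, 0, 0, 0] := by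
    funext i
    rcases lt_or_ge i 16 with h | h
    · interval_cases i <;> rfl
    · rw [cells_of_length_le (by simp), cells_of_length_le (by simpa using h)]
  rw [h0]
  refine .block' (by simp) ?_
  simp (disch := first | omega | exact of_decide_eq_true rfl) [Basic.run, WordOp.eval, update_cells,
    Nat.mod_eq_of_lt]

/-- Program for the encoding of the disjunctive safety instance, with a leading `0` if `b`. -/
def ovCmd (b : Bool) : Cmd :=
  .seq (.block ([.op .add 12 3 8, .op .add 13 2 8, .op .add 10 12 8, .op .mul 11 2 9,
    .op .add 11 10 11, .const 1 3, .op .add 5 14 8]))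
  (.seq (.block (if b then [.emit 14] else []))
  (.seq (.block [.emit 11, .emit 14, .emit 12])
  (.seq (.loop 5 10 (.block [.emit 5, .op .add 5 5 8]))
  (.seq (.block [.const 5 0])
  (.seq (.loop 5 3 (.seq (.block [.emit 8, .emit 13, .emit 14, .op .add 6 10 14])
    (.seq (rowCmd 8) (.block [.const 6 0, .op .add 5 5 8]))))
  (.seq (.block [.op .add 5 12 14])
  (.seq (.loop 5 11 (.block [.emit 14, .emit 8, .emit 14, .op .add 5 5 8]))
  (.seq (.block [.emit 4, .const 5 0])
  (.loop 5 4 (.seq (.block [.emit 13, .emit 12, .op .add 6 10 14])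
    (.seq (rowCmd 15) (.block [.const 6 0, .op .add 5 5 8]))))))))))))

/-- The encoding of the disjunctive safety instance for the vectors `us` and `vs`. -/
def safetyCode (d N₁ N₂ : ℕ) (us vs : List (List Bool)) : List ℕ :=
  (N₁ + 2 + 3 * d) :: 0 :: (N₁ + 1) :: List.range' 1 (N₁ + 1) ++
    us.flatMap (fun u => 1 :: (d + 1) :: 0 :: rowCode (N₁ + 2) 1 u) ++
    (List.range' (N₁ + 1) (3 * d + 1)).flatMap (fun _ => [0, 1, 0]) ++
    N₂ :: vs.flatMap (fun v => (d + 1) :: (N₁ + 1) :: rowCode (N₁ + 2) 2 v)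

/-- A loop that emits a header and a row for each vector. -/
theorem vectorLoop_exec {w d N₁ N₂ s k r N : ℕ} (hs : s = 8 ∧ k = 1 ∨ s = 15 ∧ k = 2)
    (hn : N₁ + 2 + 3 * d < 2 ^ w) (hN₂ : N₂ < 2 ^ w) (us : List (List Bool))
    (hus : ∀ u ∈ us, u.length = d) (head : List Basic) (header : List ℕ) (hhead : head.length ≤ 3)
    (hr : r = 3 ∧ N = N₁ ∨ r = 4 ∧ N = N₂) (hN : us.length = N)
    (hheader : ∀ p i M, (head.foldl (Basic.run w) ⟨cells (ovRegs d N₁ N₂ p i 0), M⟩) =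
      ⟨cells (ovRegs d N₁ N₂ p i 0), M ++ header⟩)
    (M pre post : List ℕ) (hM : M = pre ++ (us.flatMap (List.map Bool.toNat) ++ post))
    (hMw : M.length + N * (d + header.length) < 2 ^ w) :
    Exec w (.loop 5 r (.seq (.block (head ++ [.op .add 6 10 14]))
      (.seq (rowCmd s) (.block [.const 6 0, .op .add 5 5 8]))))
      ⟨cells (ovRegs d N₁ N₂ pre.length 0 0), M⟩ (N * (d * 18 + 16) + 2)
      ⟨cells (ovRegs d N₁ N₂ (pre.length + N * d) N 0),
        M ++ us.flatMap (fun u => header ++ rowCode (N₁ + 2) k u)⟩ := by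
  have key := Exec.foreach (w := w) (t := d * 18 + 14) (r := 5) (s := r) us (fun ys =>
    ⟨cells (ovRegs d N₁ N₂ (pre.length + ys.length * d) ys.length 0),
      M ++ ys.flatMap (fun u => header ++ rowCode (N₁ + 2) k u)⟩)
    (c := (.seq (.block (head ++ [.op .add 6 10 14]))
      (.seq (rowCmd s) (.block [.const 6 0, .op .add 5 5 8])))) ?_ ?_ ?_
  · rw [hN] at key
    simpa using key
  · intro ys x zs h
    have := congrArg List.length h
    simp at this
    rcases hr with ⟨rfl, rfl⟩ | ⟨rfl, rfl⟩ <;> simp [ovRegs] <;> omega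
  · rcases hr with ⟨rfl, rfl⟩ | ⟨rfl, rfl⟩ <;> simp [ovRegs, hN]
  · intro ys x zs h
    have hl := congrArg List.length h
    simp at hl
    have hlen (l : List (List Bool)) (hl : ∀ u ∈ l, u ∈ us) :
        (l.flatMap (List.map Bool.toNat)).length = l.length * d := by
      induction l with
      | nil => simp
      | cons a l ih =>
        rw [List.flatMap_cons, List.length_append, ih (fun u hu => hl u (by simp [hu])),
          List.length_map, hus a (hl a (by simp)), List.length_cons]
        ring
    have hlen' (l : List (List Bool)) (hl : ∀ u ∈ l, u ∈ us) :
        (l.flatMap (fun u => header ++ rowCode (N₁ + 2) k u)).length =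
          l.length * (d + header.length) := by
      induction l with
      | nil => simp
      | cons a l ih =>
        rw [List.flatMap_cons, List.length_append, ih (fun u hu => hl u (by simp [hu])),
          List.length_append, length_rowCode, hus a (hl a (by simp)), List.length_cons]
        ring
    have hys : ∀ u ∈ ys, u ∈ us := fun u hu => by simp [h, hu]
    have hlt : (ys.length + 1) * (d + header.length) ≤ N * (d + header.length) :=
      Nat.mul_le_mul_right _ (by omega)
    rw [add_mul, one_mul] at hlt
    have hNw : N < 2 ^ w := by rcases hr with ⟨rfl, rfl⟩ | ⟨rfl, rfl⟩ <;> omega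
    -- 8 bounds the cost of the header and the initialisation of register 6, `d * 18 + 2` is that of
    -- the row, and 4 that of the reset and the increment.
    refine .mono (t := 8 + (d * 18 + 2 + 4)) (by omega) (.seq (y :=
      ⟨cells (ovRegs d N₁ N₂ (pre.length + ys.length * d) ys.length (N₁ + 2)),
      M ++ ys.flatMap (fun u => header ++ rowCode (N₁ + 2) k u) ++ header⟩) ?_ (.seq
      (rowCmd_exec hs hn x (hus x (by simp [h])) _
        (pre ++ ys.flatMap (List.map Bool.toNat))
        (zs.flatMap (List.map Bool.toNat) ++ post ++
          ys.flatMap (fun u => header ++ rowCode (N₁ + 2) k u) ++ header) ?_ ?_ ?_) ?_))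
    · refine .block' (by simp; omega) ?_
      rw [List.foldl_append, hheader]
      simp (disch := first | omega | exact of_decide_eq_true rfl) [Basic.run, WordOp.eval, ovRegs,
      update_cells,
        Nat.mod_eq_of_lt]
    · rw [hM, h]; simp
    · rw [List.length_append, hlen ys hys]
    · rw [List.length_append, List.length_append, hlen' ys hys]; omega
    · refine .block' (by simp) ?_
      simp (disch := first | omega | exact of_decide_eq_true rfl) [Basic.run, WordOp.eval, ovRegs,
      update_cells,
        Nat.mod_eq_of_lt]
      refine congrArg cells ?_
      simp
      ring

/-- A loop without memory access. -/
theorem countLoop_exec {w d N₁ N₂ p r N : ℕ} (hn : N₁ + 2 + 3 * d < 2 ^ w)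
    (hr : r = 10 ∧ N = N₁ + 2 ∨ r = 11 ∧ N = N₁ + 2 + 3 * d) (l : List Basic) (g : ℕ → List ℕ)
    (hl : l.length ≤ 3)
    (hg : ∀ i M, (l.foldl (Basic.run w) ⟨cells (ovRegs d N₁ N₂ p i 0), M⟩) =
      ⟨cells (ovRegs d N₁ N₂ p i 0), M ++ g i⟩) (a c : ℕ) (hac : a + c = N) (M : List ℕ) :
    Exec w (.loop 5 r (.block (l ++ [.op .add 5 5 8]))) ⟨cells (ovRegs d N₁ N₂ p a 0), M⟩
      (c * 10 + 2) ⟨cells (ovRegs d N₁ N₂ p N 0), M ++ (List.range' a c).flatMap g⟩ := by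
  have key := Exec.foreach (w := w) (t := 8) (r := 5) (s := r) (List.range' a c) (fun ys =>
    ⟨cells (ovRegs d N₁ N₂ p (a + ys.length) 0), M ++ ys.flatMap g⟩)
    (c := .block (l ++ [.op .add 5 5 8])) ?_ ?_ ?_
  · simpa [hac] using key
  · intro ys x zs h
    have := congrArg List.length h
    simp at this
    rcases hr with ⟨rfl, rfl⟩ | ⟨rfl, rfl⟩ <;> simp [ovRegs] <;> omega
  · rcases hr with ⟨rfl, rfl⟩ | ⟨rfl, rfl⟩ <;> simp [ovRegs, hac]
  · intro ys x zs h
    have hl := congrArg List.length h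
    simp at hl
    have hx : x = a + ys.length := by
      have := congrArg (fun l => l[ys.length]?) h
      simp only [List.getElem?_append_right le_rfl, Nat.sub_self, List.getElem?_cons_zero] at this
      rw [List.getElem?_range' (by omega)] at this
      simpa using this.symm
    refine .block' (by simp; omega) ?_
    rw [List.foldl_append, hg]
    have hNw : N < 2 ^ w := by rcases hr with ⟨rfl, rfl⟩ | ⟨rfl, rfl⟩ <;> omega
    simp (disch := first | omega | exact of_decide_eq_true rfl) [Basic.run, WordOp.eval, ovRegs,
      update_cells,
        Nat.mod_eq_of_lt, hx, add_assoc]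

theorem length_flatMap {α β : Type*} {d : ℕ} {l : List (List α)} (hl : ∀ u ∈ l, u.length = d)
    (g : List α → List β) (k : ℕ) (hg : ∀ u, (g u).length = u.length + k) :
    (l.flatMap g).length = l.length * (d + k) := by
  induction l with
  | nil => simp
  | cons a l ih =>
    rw [List.flatMap_cons, List.length_append, ih (fun u hu => hl u (by simp [hu])),
      hg, hl a (by simp), List.length_cons]
    ring

theorem length_safetyCode {d : ℕ} (us vs : List (List Bool)) (hus : ∀ u ∈ us, u.length = d)
    (hvs : ∀ v ∈ vs, v.length = d) :
    (safetyCode d us.length vs.length us vs).length = us.length + 5 + us.length * (d + 3) +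
      (3 * d + 1) * 3 + vs.length * (d + 2) := by
  have hU := length_flatMap hus (fun u => 1 :: (d + 1) :: 0 :: rowCode (us.length + 2) 1 u) 3
    (by simp)
  have hV := length_flatMap hvs
    (fun u => (d + 1) :: (us.length + 1) :: rowCode (us.length + 2) 2 u) 2
    (by simp)
  simp only [safetyCode, List.length_append, List.length_cons, hU, hV, List.length_range']
  simp
  ring

theorem ovCmd_exec {w d : ℕ} (b : Bool) (us vs : List (List Bool)) (hus : ∀ u ∈ us, u.length = d)
    (hvs : ∀ v ∈ vs, v.length = d) (hn : us.length + 2 + 3 * d < 2 ^ w) {x : List ℕ}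
    (hx : x = d :: us.length :: vs.length :: (us ++ vs).flatMap (List.map Bool.toNat))
    (hw : x.length + (safetyCode d us.length vs.length us vs).length + 1 < 2 ^ w) :
    Transforms w ovLength (ovCmd b) x
      ((if b then [0] else []) ++ safetyCode d us.length vs.length us vs)
      (100 * (us.length + vs.length + 1) * (d + 1)) := by
  have hvs' := length_flatMap hvs (List.map Bool.toNat) 0 (by simp)
  have hus' := length_flatMap hus (List.map Bool.toNat) 0 (by simp)
  have hU := length_flatMap hus (fun u => 1 :: (d + 1) :: 0 :: rowCode (us.length + 2) 1 u) 3
    (by simp)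
  have hV := length_flatMap hvs
    (fun u => (d + 1) :: (us.length + 1) :: rowCode (us.length + 2) 2 u) 2
    (by simp)
  have hZ (i : ℕ) : ((List.range' i (3 * d + 1)).flatMap fun _ => [0, 1, 0]).length =
      (3 * d + 1) * 3 := by
    simp
  have hxl : x.length = (us.length + vs.length) * d + 3 := by
    rw [hx]
    simp only [List.length_cons, List.flatMap_append, List.length_append, hus', hvs']
    ring
  have hcl := length_safetyCode us vs hus hvs (d := d)
  rw [hcl, hxl] at hw
  simp only [mul_add] at hw
  have hlen2 (y z : List ℕ) : (y ++ z).length = y.length + z.length := List.length_append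
  generalize hN₁ : us.length = N₁ at *
  generalize hN₂ : vs.length = N₂ at *
  have hw0 := Nat.zero_le (N₁ * d)
  have hw1 := Nat.zero_le (N₂ * d)
  have hmul : (N₁ + N₂) * d = N₁ * d + N₂ * d := by ring
  -- The memory after the optional leading number, the vertex count with the head of the start
  -- vertex, the successors of the start vertex, the vector vertices, the remaining vertices, and
  -- the number of targets.
  set M₁ := x ++ if b then [0] else [] with hM₁
  set M₂ := M₁ ++ [N₁ + 2 + 3 * d, 0, N₁ + 1] with hM₂
  set M₃ := M₂ ++ (List.range' 1 (N₁ + 1)).flatMap (fun i => [i]) with hM₃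
  set M₄ := M₃ ++ us.flatMap (fun u => [1, d + 1, 0] ++ rowCode (N₁ + 2) 1 u) with hM₄
  set M₅ := M₄ ++ (List.range' (N₁ + 1) (3 * d + 1)).flatMap (fun _ => [0, 1, 0]) with hM₅
  set M₆ := M₅ ++ [N₂] with hM₆
  have l₁ : M₁.length ≤ (N₁ + N₂) * d + 4 := by rw [hM₁, hlen2, hxl]; cases b <;> simp
  have l₂ : M₂.length = M₁.length + 3 := by rw [hM₂, hlen2]; simp
  have l₃ : M₃.length = M₂.length + (N₁ + 1) := by rw [hM₃, hlen2]; simp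
  have l₄ : M₄.length = M₃.length + N₁ * (d + 3) := by rw [hM₄, hlen2, ← hU]; simp
  have l₅ : M₅.length = M₄.length + (3 * d + 1) * 3 := by rw [hM₅, hlen2, hZ]
  have l₆ : M₆.length = M₅.length + 1 := by rw [hM₆, hlen2]; simp
  have e₀ := ovLength_exec (w := w) (d := d) (N₁ := N₁) (N₂ := N₂)
    ((us ++ vs).flatMap (List.map Bool.toNat)) (by omega) (by omega)
  rw [← hx] at e₀
  have e₁ : Exec w (.block ([.op .add 12 3 8, .op .add 13 2 8, .op .add 10 12 8, .op .mul 11 2 9,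
      .op .add 11 10 11, .const 1 3, .op .add 5 14 8]))
      ⟨cells [(N₁ + N₂) * d + 3, 0, d, N₁, N₂, 0, 0, 0, 1, 3, 0, 0, 0, 0, 0, 2], x⟩ 14
      ⟨cells (ovRegs d N₁ N₂ 3 1 0), x⟩ := by
    refine .block' (by simp) ?_
    simp (disch := first | omega | exact of_decide_eq_true rfl) [Basic.run, WordOp.eval, ovRegs,
      update_cells,
        Nat.mod_eq_of_lt]
    refine congrArg cells ?_
    simp [mul_comm]
  have e₂ : Exec w (.block (if b then [.emit 14] else [])) ⟨cells (ovRegs d N₁ N₂ 3 1 0), x⟩ 2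
      ⟨cells (ovRegs d N₁ N₂ 3 1 0), M₁⟩ := by
    cases b <;> exact .block' (by simp) (by simp [Basic.run, ovRegs, hM₁])
  have e₃ : Exec w (.block [.emit 11, .emit 14, .emit 12]) ⟨cells (ovRegs d N₁ N₂ 3 1 0), M₁⟩ 6
      ⟨cells (ovRegs d N₁ N₂ 3 1 0), M₂⟩ :=
    .block' (by simp) (by simp [Basic.run, ovRegs, hM₂])
  have e₄ : Exec w (.loop 5 10 (.block [.emit 5, .op .add 5 5 8])) _ _
      ⟨cells (ovRegs d N₁ N₂ 3 (N₁ + 2) 0), M₃⟩ :=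
    countLoop_exec (N₂ := N₂) (p := 3) hn (Or.inl ⟨rfl, rfl⟩) [.emit 5]
      (fun i => [i]) (by simp) (by intros; rfl) 1 (N₁ + 1) (by ring) M₂
  have e₅ : Exec w (.block [.const 5 0]) ⟨cells (ovRegs d N₁ N₂ 3 (N₁ + 2) 0), M₃⟩ 2
      ⟨cells (ovRegs d N₁ N₂ 3 0 0), M₃⟩ :=
    .block' (by simp) (by simp [Basic.run, ovRegs, update_cells])
  -- The memory is split into what precedes the bits to be read, these bits, and a remainder; giving
  -- the remainder as a `drop` avoids spelling out the output so far.
  have e₆ : Exec w (.loop 5 3 (.seq (.block [.emit 8, .emit 13, .emit 14, .op .add 6 10 14])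
      (.seq (rowCmd 8) (.block [.const 6 0, .op .add 5 5 8])))) _ _
      ⟨cells (ovRegs d N₁ N₂ (3 + N₁ * d) N₁ 0), M₄⟩ :=
    vectorLoop_exec (N₂ := N₂) (Or.inl ⟨rfl, rfl⟩) hn (by omega) us hus
      [.emit 8, .emit 13, .emit 14] [1, d + 1, 0] (by simp) (Or.inl ⟨rfl, rfl⟩) hN₁
      (by intros; simp [Basic.run, ovRegs]) M₃ [d, N₁, N₂]
      (M₃.drop ((us.flatMap (List.map Bool.toNat)).length + 3))
      (by
        simp only [hM₃, hM₂, hM₁, hx, List.cons_append, List.flatMap_append, List.append_assoc]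
        simp)
      (by simp only [List.length_cons, List.length_nil, mul_add]; omega)
  have e₇ : Exec w (.block [.op .add 5 12 14]) ⟨cells (ovRegs d N₁ N₂ (3 + N₁ * d) N₁ 0), M₄⟩ 2
      ⟨cells (ovRegs d N₁ N₂ (3 + N₁ * d) (N₁ + 1) 0), M₄⟩ :=
    .block' (by simp) (by
      simp (disch := first | omega | exact of_decide_eq_true rfl) [Basic.run, WordOp.eval, ovRegs,
      update_cells,
        Nat.mod_eq_of_lt])
  have e₈ : Exec w (.loop 5 11 (.block [.emit 14, .emit 8, .emit 14, .op .add 5 5 8])) _ _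
      ⟨cells (ovRegs d N₁ N₂ (3 + N₁ * d) (N₁ + 2 + 3 * d) 0), M₅⟩ :=
    countLoop_exec (N₂ := N₂) (p := 3 + N₁ * d) hn (Or.inr ⟨rfl, rfl⟩)
      [.emit 14, .emit 8, .emit 14] (fun i => [0, 1, 0]) (by simp)
      (by intros; simp [Basic.run, ovRegs]) (N₁ + 1) (3 * d + 1) (by ring) M₄
  have e₉ : Exec w (.block [.emit 4, .const 5 0])
      ⟨cells (ovRegs d N₁ N₂ (3 + N₁ * d) (N₁ + 2 + 3 * d) 0), M₅⟩ 4
      ⟨cells (ovRegs d N₁ N₂ (d :: N₁ :: N₂ :: us.flatMap (List.map Bool.toNat)).length 0 0), M₆⟩ :=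
    .block' (by simp) (by
      rw [List.length_cons, List.length_cons, List.length_cons, hus']
      simp [Basic.run, ovRegs, update_cells, hM₆]
      refine congrArg cells ?_
      simp only [List.cons.injEq, true_and, and_true]
      omega)
  have e₁₀ : Exec w (.loop 5 4 (.seq (.block [.emit 13, .emit 12, .op .add 6 10 14])
      (.seq (rowCmd 15) (.block [.const 6 0, .op .add 5 5 8])))) _ _ _ :=
    vectorLoop_exec (N₂ := N₂) (Or.inr ⟨rfl, rfl⟩) hn (by omega) vs hvs
      [.emit 13, .emit 12] [d + 1, N₁ + 1] (by simp) (Or.inr ⟨rfl, rfl⟩) hN₂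
      (by intros; simp [Basic.run, ovRegs]) M₆ (d :: N₁ :: N₂ :: us.flatMap (List.map Bool.toNat))
      (M₆.drop (((us ++ vs).flatMap (List.map Bool.toNat)).length + 3))
      (by
        simp only [hM₆, hM₅, hM₄, hM₃, hM₂, hM₁, hx, List.cons_append, List.flatMap_append,
          List.append_assoc]
        simp [List.drop_append])
      (by simp only [List.length_cons, List.length_nil]; simp only [mul_add] at l₄ ⊢; omega)
  have e := Exec.seq e₁ (.seq e₂ (.seq e₃ (.seq e₄ (.seq e₅ (.seq e₆ (.seq e₇ (.seq e₈
    (.seq e₉ e₁₀))))))))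
  have hM : x ++ ((if b then [0] else []) ++ safetyCode d N₁ N₂ us vs) =
      M₆ ++ vs.flatMap (fun u => [d + 1, N₁ + 1] ++ rowCode (N₁ + 2) 2 u) := by
    simp [safetyCode, hM₆, hM₅, hM₄, hM₃, hM₂, hM₁]
  rw [Transforms, hxl, hM]
  refine ⟨18, _, _, (ovRegs d N₁ N₂ _ N₂ 0).tail, ?_, e₀, e, by simp [ovRegs]⟩
  ring_nf
  have := Nat.zero_le (N₁ * d)
  omega

/-! ### From satisfiability to orthogonal vectors: the program -/

/-- A literal is satisfied by the partial assignment with true variables `pos` and domain `dom`. -/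
def litSat (pos dom : ℕ) (l : ℕ × Bool) : Bool := (pos ^^^ ((!l.2).toNat * dom)).testBit l.1

/-- The encoding of a clause. -/
def clauseCode (C : List (ℕ × Bool)) : List ℕ := C.length :: C.map fun l => 2 * l.1 + l.2.toNat

/-- The registers of the program. -/
def satRegs (L m h p side off a q e flag pos dom : ℕ) : List ℕ :=
  -- Register 1 is the read pointer, 7 the current partial assignment, 8 the clause counter, 9 the
  -- end address of the clause, 10 its truth value; 11 and 12 are scratch space, 15 and 16
  -- constants.
  [L, p, m, h, 2 ^ h, side, off, a, q, e, flag, 0, 0, pos, dom, 1, 2]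

/-- Tests whether a clause is satisfied. -/
def clauseCmd : Cmd :=
  .loop 1 9 (.block [.load 11 1, .op .add 1 1 15, .op .and 12 11 15, .op .shr 11 11 15,
    .op .xor 12 12 15, .op .mul 12 12 14, .op .xor 12 13 12, .op .shr 12 12 11, .op .and 12 12 15,
    .op .or 10 10 12, .const 11 0, .const 12 0])

theorem two_mul_add_toNat_and_one (v : ℕ) (b : Bool) : (2 * v + b.toNat) &&& 1 = b.toNat := by
  rw [Nat.and_one_is_mod]
  cases b <;> simp [Nat.add_mod]

theorem two_mul_add_toNat_shiftRight (v : ℕ) (b : Bool) : (2 * v + b.toNat) >>> 1 = v := by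
  rw [Nat.shiftRight_eq_div_pow]
  cases b <;> (simp; try omega)

theorem shiftRight_and_one (x v : ℕ) : x >>> v &&& 1 = (x.testBit v).toNat := by
  rw [Nat.and_one_is_mod, Nat.toNat_testBit, Nat.shiftRight_eq_div_pow]

theorem toNat_or_toNat (a b : Bool) : a.toNat ||| b.toNat = (a || b).toNat := by
  cases a <;> cases b <;> rfl

/-- The lowest bit of a literal is its sign and the shifted word its variable, so its truth value is
computed without branching and joined to the flag by `or`. -/
theorem clauseCmd_exec {w L m h side off a q pos dom : ℕ} (hpos : pos < 2 ^ w) (hdom : dom < 2 ^ w)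
    (hw : 1 < w) (C : List (ℕ × Bool)) (M pre post : List ℕ)
    (hM : M = pre ++ ((C.map fun l => 2 * l.1 + l.2.toNat) ++ post))
    (hMw : pre.length + C.length < 2 ^ w) (hC : ∀ l ∈ C, 2 * l.1 + l.2.toNat < 2 ^ w) :
    Exec w clauseCmd
      ⟨cells (satRegs L m h pre.length side off a q (pre.length + C.length) 0 pos dom), M⟩
      (C.length * 26 + 2)
      ⟨cells (satRegs L m h (pre.length + C.length) side off a q (pre.length + C.length)
        (C.any (litSat pos dom)).toNat pos dom), M⟩ := by
  have key := Exec.foreach (w := w) (t := 24) (r := 1) (s := 9) C (fun ys =>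
    ⟨cells (satRegs L m h (pre.length + ys.length) side off a q (pre.length + C.length)
        (ys.any (litSat pos dom)).toNat pos dom), M⟩)
    (c := .block [.load 11 1, .op .add 1 1 15, .op .and 12 11 15, .op .shr 11 11 15,
    .op .xor 12 12 15, .op .mul 12 12 14, .op .xor 12 13 12, .op .shr 12 12 11, .op .and 12 12 15,
    .op .or 10 10 12, .const 11 0, .const 12 0]) ?_ ?_ ?_
  · simpa [clauseCmd] using key
  · intro ys x zs h
    have := congrArg List.length h
    simp at this
    simp [satRegs]
    omega
  · simp [satRegs]
  · intro ys x zs h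
    have hl := congrArg List.length h
    simp at hl
    have hload : cells M (pre.length + ys.length) = 2 * x.1 + x.2.toNat := by
      rw [hM, h, List.map_append, List.map_cons, ← List.append_assoc, ← List.append_assoc,
        List.append_assoc, List.cons_append]
      exact cells_append_cons (by simp)
    have hx := hC x (by simp [h])
    have hb (b : Bool) : b.toNat % 2 ^ w = b.toNat := Nat.mod_eq_of_lt (b.toNat_lt.trans_le (by
      simpa using pow_le_pow_right₀ (one_le_two (α := ℕ)) hw.le))
    have hd : (!x.2).toNat * dom < 2 ^ w := by cases x.2 <;> simp [hdom]
    have hxor : pos ^^^ ((!x.2).toNat * dom) < 2 ^ w := Nat.xor_lt_two_pow hpos hd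
    have hshr : (pos ^^^ ((!x.2).toNat * dom)) >>> x.1 < 2 ^ w :=
      (Nat.shiftRight_le _ _).trans_lt hxor
    refine .block' (by simp) ?_
    simp (disch := first | omega | exact of_decide_eq_true rfl) [Basic.run, WordOp.eval, satRegs,
      update_cells,
      Nat.mod_eq_of_lt, hload, two_mul_add_toNat_and_one, two_mul_add_toNat_shiftRight, hb,
      toNat_xor_one, shiftRight_and_one, toNat_or_toNat, Nat.mod_eq_of_lt hd,
      Nat.mod_eq_of_lt hxor, Nat.mod_eq_of_lt hshr, litSat, add_assoc,
      -Nat.and_one_is_mod]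

theorem range'_eq_append_cons {a c x : ℕ} {ys zs : List ℕ} (h : List.range' a c = ys ++ x :: zs) :
    x = a + ys.length ∧ ys.length < c := by
  have hl := congrArg List.length h
  simp at hl
  have := congrArg (fun l => l[ys.length]?) h
  simp only [List.getElem?_append_right le_rfl, Nat.sub_self, List.getElem?_cons_zero] at this
  rw [List.getElem?_range' (by omega)] at this
  exact ⟨by simpa using this.symm, by omega⟩

/-- Emits for each clause whether it is not satisfied. -/
def clausesCmd : Cmd :=
  .loop 8 2 (.seq (.block [.load 9 1, .op .add 1 1 15, .op .add 9 1 9]) (.seq clauseCmd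
    (.block [.op .xor 10 10 15, .emit 10, .const 9 0, .const 10 0, .op .add 8 8 15])))

theorem clausesCmd_exec {w L h side off a pos dom k : ℕ} (hpos : pos < 2 ^ w) (hdom : dom < 2 ^ w)
    (hw : 1 < w) (Cs : List (List (ℕ × Bool))) (hk : ∀ C ∈ Cs, C.length ≤ k) (M pre post : List ℕ)
    (hM : M = pre ++ (Cs.flatMap clauseCode ++ post))
    (hMw : (pre ++ Cs.flatMap clauseCode).length < 2 ^ w)
    (hC : ∀ C ∈ Cs, ∀ l ∈ C, 2 * l.1 + l.2.toNat < 2 ^ w) (hm : Cs.length < 2 ^ w) :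
    Exec w clausesCmd ⟨cells (satRegs L Cs.length h pre.length side off a 0 0 0 pos dom), M⟩
      (Cs.length * (k * 26 + 20) + 2)
      ⟨cells (satRegs L Cs.length h (pre ++ Cs.flatMap clauseCode).length side off a Cs.length 0 0
        pos dom), M ++ Cs.map fun C => (!C.any (litSat pos dom)).toNat⟩ := by
  have key := Exec.foreach (w := w) (t := k * 26 + 18) (r := 8) (s := 2) Cs (fun ys =>
    ⟨cells (satRegs L Cs.length h (pre ++ ys.flatMap clauseCode).length side off a ys.length 0 0
        pos dom), M ++ ys.map fun C => (!C.any (litSat pos dom)).toNat⟩)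
    (c := (.seq (.block [.load 9 1, .op .add 1 1 15, .op .add 9 1 9]) (.seq clauseCmd
    (.block [.op .xor 10 10 15, .emit 10, .const 9 0, .const 10 0, .op .add 8 8 15])))) ?_ ?_ ?_
  · simpa [clausesCmd] using key
  · intro ys x zs h
    have := congrArg List.length h
    simp at this
    simp [satRegs]
    omega
  · simp [satRegs]
  · intro ys C zs hys
    have hl := congrArg List.length hys
    simp at hl
    have hload : cells (M ++ ys.map fun C => (!C.any (litSat pos dom)).toNat)
        (pre ++ ys.flatMap clauseCode).length = C.length := by
      have : M ++ (ys.map fun C => (!C.any (litSat pos dom)).toNat) =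
          (pre ++ ys.flatMap clauseCode) ++ C.length :: ((C.map fun l => 2 * l.1 + l.2.toNat) ++
            (zs.flatMap clauseCode ++ post ++
              ys.map fun C => (!C.any (litSat pos dom)).toNat)) := by
        simp [hM, hys, clauseCode]
      rw [this]
      exact cells_append_cons rfl
    have hlt : (pre ++ ys.flatMap clauseCode).length + 1 + C.length ≤
        (pre ++ Cs.flatMap clauseCode).length := by
      simp [hys, clauseCode]; omega
    have hCk := hk C (by simp [hys])
    have e := clauseCmd_exec (L := L) (m := Cs.length) (h := h) (side := side) (off := off) (a := a)
      (q := ys.length) hpos hdom hw C (M ++ ys.map fun C => (!C.any (litSat pos dom)).toNat)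
      (pre ++ ys.flatMap clauseCode ++ [C.length])
      (zs.flatMap clauseCode ++ post ++ ys.map fun C => (!C.any (litSat pos dom)).toNat)
      (by simp [hM, hys, clauseCode]) (by rw [List.length_append, List.length_singleton]; omega)
      (hC C (by simp [hys]))
    have hend : (pre ++ (ys ++ [C]).flatMap clauseCode).length =
        (pre ++ ys.flatMap clauseCode).length + 1 + C.length := by
      simp [clauseCode]; omega
    rw [hend]
    rw [List.length_append, List.length_singleton] at e
    generalize (pre ++ ys.flatMap clauseCode).length = p at *
    refine .mono (t := 6 + (C.length * 26 + 2 + 10)) (by omega)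
      (.seq (.block' (by simp) ?_) (.seq e (.block' (by simp) ?_)))
    · simp (disch := first | omega | exact of_decide_eq_true rfl) [Basic.run, WordOp.eval, satRegs,
      update_cells,
        Nat.mod_eq_of_lt, hload]
    · have hb (b : Bool) : b.toNat % 2 ^ w = b.toNat := Nat.mod_eq_of_lt (b.toNat_lt.trans_le (by
        simpa using pow_le_pow_right₀ (one_le_two (α := ℕ)) hw.le))
      simp (disch := first | omega | exact of_decide_eq_true rfl) [Basic.run, WordOp.eval, satRegs,
      update_cells,
        Nat.mod_eq_of_lt, toNat_xor_one, hb]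

/-- Emits the vectors of all partial assignments with one of the two domains. -/
def halfCmd : Cmd :=
  .loop 7 4 (.seq (.block [.op .shl 13 7 6, .const 1 2]) (.seq clausesCmd
    (.block [.const 13 0, .const 1 0, .const 8 0, .op .add 7 7 15])))

/-- The vectors of all assignments to the variables from `off` to `off + h - 1`. -/
def halfCode (Cs : List (List (ℕ × Bool))) (h off : ℕ) : List ℕ :=
  (List.range' 0 (2 ^ h)).flatMap fun a =>
    Cs.map fun C => (!C.any (litSat (a <<< off) ((2 ^ h - 1) <<< off))).toNat

theorem halfCmd_exec {w L h side off n k : ℕ} (hw : h + off < w) (hw1 : 1 < w)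
    (Cs : List (List (ℕ × Bool))) (hk : ∀ C ∈ Cs, C.length ≤ k) (M post : List ℕ)
    (hM : M = n :: Cs.length :: (Cs.flatMap clauseCode ++ post))
    (hMw : (Cs.flatMap clauseCode).length + 2 < 2 ^ w)
    (hC : ∀ C ∈ Cs, ∀ l ∈ C, 2 * l.1 + l.2.toNat < 2 ^ w) (hm : Cs.length < 2 ^ w) :
    Exec w halfCmd
      ⟨cells (satRegs L Cs.length h 0 side off 0 0 0 0 0 ((2 ^ h - 1) <<< off)), M⟩
      (2 ^ h * (Cs.length * (k * 26 + 20) + 16) + 2)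
      ⟨cells (satRegs L Cs.length h 0 side off (2 ^ h) 0 0 0 0 ((2 ^ h - 1) <<< off)),
        M ++ halfCode Cs h off⟩ := by
  have key := Exec.foreach (w := w) (t := Cs.length * (k * 26 + 20) + 14) (r := 7) (s := 4)
    (List.range' 0 (2 ^ h)) (fun ys =>
    ⟨cells (satRegs L Cs.length h 0 side off ys.length 0 0 0 0 ((2 ^ h - 1) <<< off)),
      M ++ ys.flatMap fun a =>
        Cs.map fun C => (!C.any (litSat (a <<< off) ((2 ^ h - 1) <<< off))).toNat⟩)
    (c := .seq (.block [.op .shl 13 7 6, .const 1 2]) (.seq clausesCmd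
    (.block [.const 13 0, .const 1 0, .const 8 0, .op .add 7 7 15]))) ?_ ?_ ?_
  · simpa [halfCmd, halfCode] using key
  · intro ys x zs h
    simpa [satRegs] using (range'_eq_append_cons h).2
  · simp [satRegs]
  · intro ys x zs hys
    obtain ⟨rfl, hx⟩ := range'_eq_append_cons hys
    have hshl (b : ℕ) (hb : b < 2 ^ h) : b <<< off < 2 ^ w := by
      rw [Nat.shiftLeft_eq]
      calc b * 2 ^ off < 2 ^ h * 2 ^ off := Nat.mul_lt_mul_of_pos_right hb (by positivity)
        _ = 2 ^ (h + off) := (pow_add _ _ _).symm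
        _ ≤ 2 ^ w := pow_le_pow_right₀ one_le_two hw.le
    have hH : 2 ^ h < 2 ^ w := pow_lt_pow_right₀ one_lt_two (by omega)
    have h0 : 0 < 2 ^ h := by positivity
    have h2 : 2 < 2 ^ w := by simpa using pow_lt_pow_right₀ (one_lt_two (α := ℕ)) hw1
    have e := clausesCmd_exec (L := L) (h := h) (side := side) (off := off) (a := ys.length)
      (hshl ys.length hx) (hshl (2 ^ h - 1) (by omega)) hw1 Cs hk
      (M ++ ys.flatMap fun a =>
        Cs.map fun C => (!C.any (litSat (a <<< off) ((2 ^ h - 1) <<< off))).toNat) [n, Cs.length]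
      (post ++ ys.flatMap fun a =>
        Cs.map fun C => (!C.any (litSat (a <<< off) ((2 ^ h - 1) <<< off))).toNat)
      (by simp [hM]) (by simpa using hMw) hC hm
    refine .mono (t := 4 + (Cs.length * (k * 26 + 20) + 2 + 8)) (by omega)
      (.seq (.block' (by simp) ?_) (.seq e (.block' (by simp) ?_)))
    · simp (disch := first | omega | exact of_decide_eq_true rfl) [Basic.run, WordOp.eval, satRegs,
      update_cells,
        Nat.mod_eq_of_lt, Nat.mod_eq_of_lt (hshl _ hx)]
    · simp (disch := first | omega | exact of_decide_eq_true rfl) [Basic.run, WordOp.eval, satRegs,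
      update_cells,
        Nat.mod_eq_of_lt]

/-- Program that computes the length of the input. -/
def satLength : Cmd :=
  .seq (.block [.const 15 1, .const 16 2, .load 3 12, .load 2 15, .op .add 3 3 15, .op .div 3 3 16,
    .op .shl 4 15 3, .const 1 2])
  (.seq (.loop 8 2 (.block [.load 9 1, .op .add 1 1 15, .op .add 1 1 9, .const 9 0,
    .op .add 8 8 15]))
  (.block [.op .or 0 1 1, .const 1 0, .const 8 0]))

theorem cells_replicate_zero (n : ℕ) : cells (List.replicate n 0) = cells [] := by
  funext i
  simp only [cells, List.getD_eq_getElem?_getD, List.getElem?_replicate]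
  split_ifs <;> rfl

/-- A formula's encoding does not state its own length; the loop finds it by hopping from one clause
length to the next. -/
theorem satLength_exec {w n : ℕ} (Cs : List (List (ℕ × Bool))) (hn : n + 2 < w)
    {x : List ℕ} (hx : x = n :: Cs.length :: Cs.flatMap clauseCode) (hxw : x.length < 2 ^ w)
    (hm : Cs.length < 2 ^ w) :
    Exec w satLength ⟨cells [], x⟩ (24 + Cs.length * 12)
      ⟨cells (satRegs x.length Cs.length ((n + 1) / 2) 0 0 0 0 0 0 0 0 0), x⟩ := by
  have hnw : n + 2 < 2 ^ w := hn.trans w.lt_two_pow_self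
  have hH : 2 ^ ((n + 1) / 2) < 2 ^ w := pow_lt_pow_right₀ one_lt_two (by omega)
  have key := Exec.foreach (w := w) (t := 10) (r := 8) (s := 2) Cs (fun ys =>
    ⟨cells (satRegs 0 Cs.length ((n + 1) / 2) ((ys.flatMap clauseCode).length + 2) 0 0 0 ys.length
      0 0 0 0), x⟩)
    (c := .block [.load 9 1, .op .add 1 1 15, .op .add 1 1 9, .const 9 0,
    .op .add 8 8 15]) ?_ ?_ ?_
  · refine .mono (t := 16 + (Cs.length * (10 + 2) + 2 + 6)) (by omega)
      (.seq (.block' (by simp) ?_) (.seq key (.block' (by simp) ?_)))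
    · rw [← cells_replicate_zero 17]
      simp (disch := first | omega | exact of_decide_eq_true rfl) [Basic.run, WordOp.eval, satRegs,
        update_cells, Nat.mod_eq_of_lt, List.replicate, hx, Nat.shiftLeft_eq]
    · have : x.length = (Cs.flatMap clauseCode).length + 2 := by simp [hx]
      rw [this] at hxw ⊢
      generalize (Cs.flatMap clauseCode).length = p at *
      simp (disch := first | omega | exact of_decide_eq_true rfl) [Basic.run, WordOp.eval, satRegs,
        update_cells, Nat.mod_eq_of_lt]
  · intro ys C zs h
    have := congrArg List.length h
    simp at this
    simp [satRegs]
    omega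
  · simp [satRegs]
  · intro ys C zs hys
    have hl := congrArg List.length hys
    simp at hl
    have hload : cells x ((ys.flatMap clauseCode).length + 2) = C.length := by
      have : x = (n :: Cs.length :: ys.flatMap clauseCode) ++ C.length ::
          ((C.map fun l => 2 * l.1 + l.2.toNat) ++ zs.flatMap clauseCode) := by
        simp [hx, hys, clauseCode]
      rw [this]
      exact cells_append_cons (by simp)
    have hend : ((ys ++ [C]).flatMap clauseCode).length =
        (ys.flatMap clauseCode).length + 1 + C.length := by
      simp [clauseCode]; omega
    have hlt : (ys.flatMap clauseCode).length + 2 + 1 + C.length ≤ x.length := by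
      simp [hx, hys, clauseCode]; omega
    rw [hend]
    generalize (ys.flatMap clauseCode).length = p at *
    refine .block' (by simp) ?_
    simp (disch := first | omega | exact of_decide_eq_true rfl) [Basic.run, WordOp.eval, satRegs,
      update_cells, Nat.mod_eq_of_lt, hload]
    refine congrArg cells ?_
    simp only [List.cons.injEq, true_and, and_true]
    omega

/-- Program for the encoding of the orthogonal vectors instance. -/
def satCmd : Cmd :=
  .seq (.block [.emit 2, .emit 4, .emit 4])
  (.loop 5 16 (.seq (.block [.op .sub 14 4 15, .op .shl 14 14 6])
    (.seq halfCmd (.block [.const 7 0, .op .add 6 6 3, .op .add 5 5 15, .const 14 0]))))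

/-- The encoding of the orthogonal vectors instance. -/
def satCode (Cs : List (List (ℕ × Bool))) (h : ℕ) : List ℕ :=
  Cs.length :: 2 ^ h :: 2 ^ h :: (halfCode Cs h 0 ++ halfCode Cs h h)

/-- With `h = (n + 1) / 2`, assignments and masks shifted by at most `h` occupy at most `2 h ≤ n +
1` bits, so `n + 2 < w` lets them fit into a word. -/
theorem satCmd_exec {w n k : ℕ} (Cs : List (List (ℕ × Bool))) (hk : ∀ C ∈ Cs, C.length ≤ k)
    (hn : n + 2 < w) {x : List ℕ} (hx : x = n :: Cs.length :: Cs.flatMap clauseCode)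
    (hxw : x.length < 2 ^ w) (hm : Cs.length < 2 ^ w)
    (hC : ∀ C ∈ Cs, ∀ l ∈ C, 2 * l.1 + l.2.toNat < 2 ^ w) :
    Transforms w satLength satCmd x (satCode Cs ((n + 1) / 2))
      (100 * (k + 1) * (Cs.length + 1) * 2 ^ ((n + 1) / 2)) := by
  have e₀ := satLength_exec Cs hn hx hxw hm
  have hnw : n + 2 < 2 ^ w := hn.trans w.lt_two_pow_self
  have hh : (n + 1) / 2 + (n + 1) / 2 < w := by omega
  have hxl : x.length = (Cs.flatMap clauseCode).length + 2 := by simp [hx]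
  have h1 : 1 ≤ 2 ^ ((n + 1) / 2) := Nat.one_le_two_pow
  generalize (n + 1) / 2 = h at *
  have hhw : h + h < 2 ^ w := hh.trans w.lt_two_pow_self
  have hHw : 2 ^ h < 2 ^ w := pow_lt_pow_right₀ one_lt_two (by omega)
  have key := Exec.foreach (w := w) (t := 2 ^ h * (Cs.length * (k * 26 + 20) + 16) + 14) (r := 5)
    (s := 16) (List.range' 0 2) (fun ys =>
      ⟨cells (satRegs x.length Cs.length h 0 ys.length (ys.length * h) 0 0 0 0 0 0),
        x ++ [Cs.length, 2 ^ h, 2 ^ h] ++ ys.flatMap fun i => halfCode Cs h (i * h)⟩)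
    (c := .seq (.block [.op .sub 14 4 15, .op .shl 14 14 6])
    (.seq halfCmd (.block [.const 7 0, .op .add 6 6 3, .op .add 5 5 15, .const 14 0]))) ?_ ?_ ?_
  · refine ⟨_, 6 + (2 * (2 ^ h * (Cs.length * (k * 26 + 20) + 16) + 14 + 2) + 2), _,
      (satRegs x.length Cs.length h 0 2 (2 * h) 0 0 0 0 0 0).tail, ?_, e₀,
      .seq (t := 6) (y := ⟨cells (satRegs x.length Cs.length h 0 0 0 0 0 0 0 0 0),
        x ++ [Cs.length, 2 ^ h, 2 ^ h]⟩) (.block' (by simp) ?_) ?_, by simp [satRegs]⟩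
    rotate_left
    · simp [Basic.run, satRegs]
    · simp [List.range'] at key
      simpa [satCode, satRegs] using key
    · have h2 := Nat.zero_le (k * Cs.length)
      have h3 : Cs.length ≤ Cs.length * 2 ^ h := Nat.le_mul_of_pos_right _ h1
      generalize Cs.length = m at *
      generalize 2 ^ h = H at *
      ring_nf
      have h4 := Nat.zero_le (k * m * H)
      have h5 := Nat.zero_le (k * H)
      nlinarith
  · intro ys y zs h
    simpa [satRegs] using (range'_eq_append_cons h).2
  · simp [satRegs]
  · intro ys y zs hys
    obtain ⟨rfl, hy⟩ := range'_eq_append_cons hys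
    have hoff : ys.length * h ≤ h := by
      have : ys.length ≤ 1 := by omega
      calc ys.length * h ≤ 1 * h := Nat.mul_le_mul_right _ this
        _ = h := one_mul _
    have hsub : (2 ^ h + (2 ^ w - 1)) % 2 ^ w = 2 ^ h - 1 := by
      rw [show 2 ^ h + (2 ^ w - 1) = 2 ^ h - 1 + 2 ^ w by omega, Nat.add_mod_right,
        Nat.mod_eq_of_lt (by omega)]
    have hshl : (2 ^ h - 1) <<< (ys.length * h) < 2 ^ w := by
      rw [Nat.shiftLeft_eq]
      calc (2 ^ h - 1) * 2 ^ (ys.length * h) < 2 ^ h * 2 ^ (ys.length * h) :=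
            Nat.mul_lt_mul_of_pos_right (by omega) (by positivity)
        _ = 2 ^ (h + ys.length * h) := (pow_add _ _ _).symm
        _ ≤ 2 ^ w := pow_le_pow_right₀ one_le_two (by omega)
    have e := halfCmd_exec (L := x.length) (h := h) (side := ys.length) (off := ys.length * h)
      (n := n) (by omega) (by omega) Cs hk
      (x ++ [Cs.length, 2 ^ h, 2 ^ h] ++ ys.flatMap fun i => halfCode Cs h (i * h))
      ([Cs.length, 2 ^ h, 2 ^ h] ++ ys.flatMap fun i => halfCode Cs h (i * h))
      (by simp [hx]) (by omega) hC hm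
    refine .mono (t := 4 + (2 ^ h * (Cs.length * (k * 26 + 20) + 16) + 2 + 8)) (by omega)
      (.seq (.block' (by simp) ?_) (.seq e (.block' (by simp) ?_)))
    · simp (disch := first | omega | exact of_decide_eq_true rfl) [Basic.run, WordOp.eval, satRegs,
        update_cells, hsub, Nat.mod_eq_of_lt hshl]
    · simp (disch := first | omega | exact of_decide_eq_true rfl) [Basic.run, WordOp.eval, satRegs,
        update_cells, Nat.mod_eq_of_lt, add_mul]

/-! ### From satisfiability to orthogonal vectors: correctness -/

/-- For a negative literal the xor complements the assignment within its domain. Outside the domain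
both words have zero bits, so neither sign is satisfied there. -/
theorem litSat_shiftLeft {a h off v : ℕ} {b : Bool} (ha : a < 2 ^ h) :
    litSat (a <<< off) ((2 ^ h - 1) <<< off) (v, b) =
      (decide (off ≤ v ∧ v < off + h) && (a.testBit (v - off) == b)) := by
  have hlt : h ≤ v - off → a.testBit (v - off) = false := fun hv =>
    Nat.testBit_lt_two_pow (ha.trans_le (pow_le_pow_right₀ one_le_two hv))
  rw [litSat, Nat.testBit_xor, Nat.testBit_shiftLeft]
  cases b with
  | true =>
    by_cases h1 : off ≤ v <;> by_cases h2 : v < off + h <;> simp [h1, h2]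
    exact hlt (by omega)
  | false =>
    simp only [Bool.not_false, Bool.toNat_true, one_mul, Nat.testBit_shiftLeft,
      Nat.testBit_two_pow_sub_one]
    by_cases h1 : off ≤ v
    · by_cases h2 : v < off + h
      · have h3 : v - off < h := by omega
        simp [h1, h2, h3]
      · have h3 : ¬ v - off < h := by omega
        simp [h1, h2, h3, hlt (by omega)]
    · simp [h1]

namespace CNF

variable (φ : CNF)

/-- The clauses with natural numbers as variables. -/
def natClauses : List (List (ℕ × Bool)) := φ.clauses.map fun C => C.map fun l => (l.1.val, l.2)

theorem encode_eq : φ.encode = φ.n :: φ.natClauses.length :: φ.natClauses.flatMap clauseCode := by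
  simp [encode, natClauses, clauseCode, m, List.flatMap_map, Function.comp_def]

/-- Half of the number of variables. -/
def half : ℕ := (φ.n + 1) / 2

/-- The clauses that an assignment to the variables from `off` to `off + half - 1` does not
satisfy. -/
def vector (off a : ℕ) : Fin φ.natClauses.length → Bool := fun j =>
  !φ.natClauses[j].any (litSat (a <<< off) ((2 ^ φ.half - 1) <<< off))

/-- The orthogonal vectors instance of a formula. -/
def toOV : OVInstance where
  d := φ.natClauses.length
  S₁ := (List.range' 0 (2 ^ φ.half)).map (φ.vector 0)
  S₂ := (List.range' 0 (2 ^ φ.half)).map (φ.vector φ.half)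

theorem toOV_encode : φ.toOV.encode = satCode φ.natClauses φ.half := by
  have h (off : ℕ) : ((List.range' 0 (2 ^ φ.half)).map (φ.vector off)).flatMap
      (fun u => List.ofFn fun i => (u i).toNat) = halfCode φ.natClauses φ.half off := by
    rw [List.flatMap_map, halfCode]
    congr 1
    funext a
    refine List.ext_getElem (by simp) fun i h1 h2 => ?_
    simp [vector]
  change [φ.natClauses.length, ((List.range' 0 (2 ^ φ.half)).map (φ.vector 0)).length,
    ((List.range' 0 (2 ^ φ.half)).map (φ.vector φ.half)).length] ++
    ((List.range' 0 (2 ^ φ.half)).map (φ.vector 0) ++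
      (List.range' 0 (2 ^ φ.half)).map (φ.vector φ.half)).flatMap
      (fun u => List.ofFn fun i => (u i).toNat) = _
  rw [List.flatMap_append, h, h]
  simp [satCode]

theorem getElem_natClauses (i : ℕ) (hi : i < φ.natClauses.length) :
    φ.natClauses[i] = (φ.clauses[i]'(by simpa [natClauses] using hi)).map
      fun l => (l.1.val, l.2) := by
  simp [natClauses]

/-- A zero product in each coordinate says that every clause has a literal satisfied by one of the
two halves, that is, by the combined assignment. -/
theorem toOV_hasOrthogonalPair : φ.toOV.HasOrthogonalPair ↔ φ.Satisfiable := by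
  have key (a a' : ℕ) (ha : a < 2 ^ φ.half) (ha' : a' < 2 ^ φ.half) :
      (∑ i, (φ.vector 0 a i).toNat * (φ.vector φ.half a' i).toNat = 0) ↔ ∀ C ∈ φ.clauses,
        ∃ l ∈ C, (if l.1.val < φ.half then a.testBit l.1 else a'.testBit (l.1 - φ.half)) = l.2 := by
    have hlit (l : Fin φ.n × Bool) :
        (litSat (a <<< 0) ((2 ^ φ.half - 1) <<< 0) (l.1.val, l.2) = true ∨
          litSat (a' <<< φ.half) ((2 ^ φ.half - 1) <<< φ.half) (l.1.val, l.2) = true) ↔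
        (if l.1.val < φ.half then a.testBit l.1 else a'.testBit (l.1 - φ.half)) = l.2 := by
      rw [litSat_shiftLeft ha, litSat_shiftLeft ha']
      have h1 := l.1.isLt
      have h2 : φ.n ≤ φ.half + φ.half := by unfold half; omega
      by_cases h : l.1.val < φ.half
      · simp [h, not_le.2 h]
      · have h3 : l.1.val < φ.half + φ.half := by omega
        simp [h, not_lt.1 h, h3]
    simp only [Finset.sum_eq_zero_iff, Finset.mem_univ, true_imp_iff, mul_eq_zero,
      Bool.toNat_eq_zero, vector, Bool.not_eq_false', List.any_eq_true]
    constructor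
    · intro h C hC
      obtain ⟨i, hi, rfl⟩ := List.getElem_of_mem hC
      have := h ⟨i, by simpa [natClauses] using hi⟩
      simp only [Fin.getElem_fin, getElem_natClauses, List.mem_map] at this
      rcases this with ⟨_, ⟨l, hl, rfl⟩, h⟩ | ⟨_, ⟨l, hl, rfl⟩, h⟩
      · exact ⟨l, hl, (hlit l).1 (Or.inl h)⟩
      · exact ⟨l, hl, (hlit l).1 (Or.inr h)⟩
    · intro h i
      obtain ⟨l, hl, h⟩ := h (φ.clauses[i]'(by simpa [natClauses] using i.isLt))
        (List.getElem_mem _)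
      simp only [Fin.getElem_fin, getElem_natClauses, List.mem_map]
      rcases (hlit l).2 h with h | h
      · exact Or.inl ⟨_, ⟨l, hl, rfl⟩, h⟩
      · exact Or.inr ⟨_, ⟨l, hl, rfl⟩, h⟩
  constructor
  · rintro ⟨u, hu, v, hv, h⟩
    obtain ⟨a, ha, rfl⟩ := List.mem_map.1 (show u ∈ List.map (φ.vector 0) _ from hu)
    obtain ⟨a', ha', rfl⟩ := List.mem_map.1 (show v ∈ List.map (φ.vector φ.half) _ from hv)
    simp only [List.mem_range'_1, zero_add] at ha ha'
    exact ⟨fun i => if i.val < φ.half then a.testBit i else a'.testBit (i - φ.half),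
      (key a a' ha.2 ha'.2).1 h⟩
  · rintro ⟨α, hα⟩
    -- If `n` is odd, the second half includes the index `n`, which is no variable; its value is
    -- irrelevant.
    let β : ℕ → Bool := fun i => if h : i < φ.n then α ⟨i, h⟩ else false
    have hb (off : ℕ) : ∃ a < 2 ^ φ.half, ∀ i < φ.half, a.testBit i = β (off + i) :=
      ⟨Nat.ofBits fun i : Fin φ.half => β (off + i), Nat.ofBits_lt_two_pow _,
        fun i hi => Nat.testBit_ofBits_lt _ _ hi⟩
    obtain ⟨a, ha, h1⟩ := hb 0
    obtain ⟨a', ha', h2⟩ := hb φ.half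
    refine ⟨_, List.mem_map.2 ⟨a, by simpa using ha, rfl⟩, _,
      List.mem_map.2 ⟨a', by simpa using ha', rfl⟩, (key a a' ha ha').2 fun C hC => ?_⟩
    obtain ⟨l, hl, h⟩ := hα C hC
    refine ⟨l, hl, ?_⟩
    have h3 := l.1.isLt
    have h4 : φ.n ≤ φ.half + φ.half := by unfold half; omega
    rw [← h]
    split_ifs with h5
    · rw [h1 _ h5]; simp [β]
    · rw [h2 _ (by omega), Nat.add_sub_of_le (not_lt.1 h5)]; simp [β]

end CNF

/-! ### From orthogonal vectors to disjunctive safety: the instance -/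

/-- A strictly increasing list is the sorted enumeration of the set of its entries. -/
theorem encodeFinset_filter {n : ℕ} {l : List ℕ} (hl : l.Pairwise (· < ·)) (hn : ∀ a ∈ l, a < n) :
    encodeFinset (Finset.univ.filter fun v : Fin n => v.val ∈ l) = l.length :: l := by
  set s := Finset.univ.filter fun v : Fin n => v.val ∈ l with hs
  have h : s.sort.map Fin.val = l := by
    refine List.Perm.eq_of_pairwise (le := (· < ·)) (fun a b _ _ h h' => absurd h h'.not_gt)
      ?_ hl ?_
    · have := s.sortedLT_sort.pairwise
      exact List.pairwise_map.2 (this.imp fun h => h)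
    · rw [List.perm_ext_iff_of_nodup]
      · intro a
        simp only [List.mem_map, Finset.mem_sort, hs, Finset.mem_filter, Finset.mem_univ, true_and]
        exact ⟨fun ⟨v, hv, h⟩ => h ▸ hv, fun h => ⟨⟨a, hn a h⟩, h, rfl⟩⟩
      · exact (s.sort_nodup _).map Fin.val_injective
      · exact hl.imp fun h => h.ne
  have hc : s.card = l.length := by rw [← h, List.length_map, Finset.length_sort]
  rw [encodeFinset, h, hc]

theorem mem_rowCode {base k x : ℕ} {bs : List Bool} :
    x ∈ rowCode base k bs ↔
      ∃ (j : ℕ) (h : j < bs.length), x = base + 3 * j + k * (!bs[j]).toNat := by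
  simp only [rowCode, List.mem_mapIdx, eq_comm]

theorem rowCode_pairwise {base k : ℕ} (hk : k ≤ 2) (bs : List Bool) :
    (rowCode base k bs).Pairwise (· < ·) := by
  rw [List.pairwise_iff_getElem]
  intro i j hi hj hij
  simp only [rowCode, List.getElem_mapIdx]
  have := (!bs[i]'(by simpa using hi)).toNat_le
  have : k * (!bs[i]'(by simpa using hi)).toNat ≤ 2 * 1 := Nat.mul_le_mul hk this
  omega

namespace OVInstance

variable (x : OVInstance)

/-- For each vertex of the safety instance its kind (`1` for random vertices) and its successors.
Vertex `0` is the start vertex.  It is followed by vertices for the vectors in `S₁`, a vertex that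
all target sets contain, and three vertices for each coordinate. -/
def vertexData : List (ℕ × List ℕ) :=
  (0, List.range' 1 (x.S₁.length + 1)) ::
    (x.S₁.map fun u => (1, 0 :: rowCode (x.S₁.length + 2) 1 (List.ofFn u))) ++
    (List.range' (x.S₁.length + 1) (3 * x.d + 1)).map fun _ => (0, [0])

/-- The target set of a vector in `S₂`. -/
def targetData (v : Fin x.d → Bool) : List ℕ :=
  (x.S₁.length + 1) :: rowCode (x.S₁.length + 2) 2 (List.ofFn v)

theorem length_vertexData : x.vertexData.length = x.S₁.length + 2 + 3 * x.d := by
  simp [vertexData]; omega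

theorem rowCode_lt {k y : ℕ} (hk : k ≤ 2) (u : Fin x.d → Bool)
    (hy : y ∈ rowCode (x.S₁.length + 2) k (List.ofFn u)) :
    x.S₁.length + 2 ≤ y ∧ y < x.vertexData.length := by
  obtain ⟨j, hj, rfl⟩ := mem_rowCode.1 hy
  rw [List.length_ofFn] at hj
  have : k * (!(List.ofFn u)[j]'(by simpa using hj)).toNat ≤ 2 * 1 :=
    Nat.mul_le_mul hk (Bool.toNat_le _)
  rw [x.length_vertexData]
  omega

theorem vertexData_spec {p : ℕ × List ℕ} (hp : p ∈ x.vertexData) : (p.1 = 0 ∨ p.1 = 1) ∧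
    p.2 ≠ [] ∧ p.2.Pairwise (· < ·) ∧ ∀ a ∈ p.2, a < x.vertexData.length := by
  simp only [vertexData, List.cons_append, List.mem_cons, List.mem_append, List.mem_map] at hp
  rcases hp with rfl | ⟨u, -, rfl⟩ | ⟨i, -, rfl⟩
  · refine ⟨Or.inl rfl, by simp, List.pairwise_lt_range', fun a ha => ?_⟩
    rw [List.mem_range'_1] at ha
    rw [x.length_vertexData]; omega
  · refine ⟨Or.inr rfl, by simp, List.pairwise_cons.2
      ⟨fun a ha => ?_, rowCode_pairwise (by simp) _⟩,
      fun a ha => ?_⟩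
    · have := x.rowCode_lt (by simp) u ha; omega
    · rcases List.mem_cons.1 ha with rfl | ha
      · rw [x.length_vertexData]; omega
      · exact (x.rowCode_lt (by simp) u ha).2
  · refine ⟨Or.inl rfl, by simp, by simp, fun a ha => ?_⟩
    rw [List.mem_singleton.1 ha, x.length_vertexData]; omega

theorem targetData_spec (v : Fin x.d → Bool) : (x.targetData v).Pairwise (· < ·) ∧
    ∀ a ∈ x.targetData v, a < x.vertexData.length := by
  refine ⟨List.pairwise_cons.2 ⟨fun a ha => ?_, rowCode_pairwise le_rfl _⟩, fun a ha => ?_⟩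
  · have := x.rowCode_lt le_rfl v ha; omega
  · rcases List.mem_cons.1 ha with rfl | ha
    · rw [x.length_vertexData]; omega
    · exact (x.rowCode_lt le_rfl v ha).2

/-- The Markov decision process of an orthogonal vectors instance. -/
def toMDP : MDP x.vertexData.length where
  succ v := Finset.univ.filter fun u => u.val ∈ x.vertexData[v].2
  succ_nonempty v := by
    obtain ⟨-, h, -, hlt⟩ := x.vertexData_spec (List.getElem_mem v.isLt)
    obtain ⟨a, ha⟩ := List.exists_mem_of_ne_nil _ h
    exact ⟨⟨a, hlt a ha⟩, by simpa using ha⟩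
  random := Finset.univ.filter fun v => x.vertexData[v].1 = 1

/-- The target set of a vector in `S₂`. -/
def target (v : Fin x.d → Bool) : Finset (Fin x.vertexData.length) :=
  Finset.univ.filter fun u => u.val ∈ x.targetData v

/-- The disjunctive safety instance of an orthogonal vectors instance. -/
def toSafety : SafetyInstance where
  n := x.vertexData.length
  mdp := x.toMDP
  targets := x.S₂.map x.target

theorem encode_eq : x.encode = x.d :: x.S₁.length :: x.S₂.length ::
    (x.S₁.map List.ofFn ++ x.S₂.map List.ofFn).flatMap (List.map Bool.toNat) := by
  simp [encode, List.flatMap_map, Function.comp_def, List.map_ofFn]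

theorem toSafety_encode : x.toSafety.encode =
    safetyCode x.d x.S₁.length x.S₂.length (x.S₁.map List.ofFn) (x.S₂.map List.ofFn) := by
  have h1 : (List.finRange x.vertexData.length).flatMap
      (fun v => (if v ∈ x.toMDP.random then 1 else 0) :: encodeFinset (x.toMDP.succ v)) =
      x.vertexData.flatMap fun p => p.1 :: p.2.length :: p.2 := by
    have h (v : Fin x.vertexData.length) :
        (if v ∈ x.toMDP.random then 1 else 0) :: encodeFinset (x.toMDP.succ v) =
        (fun p : ℕ × List ℕ => p.1 :: p.2.length :: p.2) (x.vertexData[v]) := by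
      obtain ⟨h1, -, h2, h3⟩ := x.vertexData_spec (List.getElem_mem v.isLt)
      simp only [toMDP, encodeFinset_filter h2 h3, Finset.mem_filter, Finset.mem_univ, true_and,
        Fin.getElem_fin]
      rcases h1 with h1 | h1 <;> simp [h1]
    simp only [h]
    conv_rhs => rw [← List.map_getElem_finRange x.vertexData, List.flatMap_map]
    rfl
  have h2 : (x.S₂.map x.target).flatMap encodeFinset =
      x.S₂.flatMap fun v => (x.targetData v).length :: x.targetData v := by
    rw [List.flatMap_map]
    congr 1
    funext v
    exact encodeFinset_filter (x.targetData_spec v).1 (x.targetData_spec v).2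
  change x.vertexData.length :: (List.finRange x.vertexData.length).flatMap
      (fun v => (if v ∈ x.toMDP.random then 1 else 0) :: encodeFinset (x.toMDP.succ v)) ++
      (x.S₂.map x.target).length :: (x.S₂.map x.target).flatMap encodeFinset = _
  rw [h1, h2, List.length_map, x.length_vertexData]
  simp [vertexData, targetData, safetyCode, List.flatMap_map, -List.map_const_fun, -List.map_const']

end OVInstance

/-! ### Plays of Markov decision processes -/

open MeasureTheory ProbabilityTheory Preorder

namespace MDP

variable {n : ℕ} {P : MDP n} (σ : P.Strategy) (v : Fin n)

instance : IsProbabilityMeasure (σ.prob v) := by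
  unfold Strategy.prob; infer_instance

theorem Strategy.prob_history_zero :
    σ.prob v {ω | frestrictLe (π := fun _ => Fin n) 0 ω = fun _ => v} = 1 := by
  have h := Kernel.traj_map_frestrictLe_apply (X := fun _ => Fin n) (κ := σ.kernel) 0 0 (fun _ => v)
  rw [Kernel.partialTraj_self, Kernel.id_apply] at h
  have h' := congrArg (fun μ => μ {fun _ => v}) h
  rw [Measure.map_apply (measurable_frestrictLe _) (measurableSet_singleton _),
    Measure.dirac_apply' _ (measurableSet_singleton _),
    Set.indicator_of_mem (Set.mem_singleton _), Pi.one_apply] at h'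
  exact h'

/-- The joint law of a history and the next vertex is the composition product of the law of the
history with the kernel; on a product of two singletons the integral reduces to a product. -/
theorem Strategy.prob_history_succ (j : ℕ) (h : History n j) (a : Fin n) :
    σ.prob v {ω | frestrictLe (π := fun _ => Fin n) j ω = h ∧ ω (j + 1) = a} =
      σ.prob v {ω | frestrictLe (π := fun _ => Fin n) j ω = h} * σ.stepMeasure j h {a} := by
  have h1 := Kernel.partialTraj_compProd_eq_map_traj (X := fun _ => Fin n) (κ := σ.kernel)
    (Nat.zero_le j) (x₀ := fun _ => v)
  have h2 := Kernel.traj_map_frestrictLe_apply (X := fun _ => Fin n) (κ := σ.kernel) 0 j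
    (fun _ => v)
  have h3 := congrArg (fun μ => μ ({h} ×ˢ {a})) h1
  rw [Measure.compProd_apply_prod (measurableSet_singleton _) (measurableSet_singleton _),
    Measure.restrict_singleton, lintegral_smul_measure, lintegral_dirac,
    Measure.map_apply (by fun_prop) ((measurableSet_singleton _).prod (measurableSet_singleton _)),
    ← h2, Measure.map_apply (measurable_frestrictLe _) (measurableSet_singleton _)] at h3
  exact h3.symm

/-- The vertices that can follow a history. -/
theorem Strategy.stepMeasure_pos {j : ℕ} {h : History n j} {a : Fin n} :
    σ.stepMeasure j h {a} ≠ 0 ↔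
      if h.last ∈ P.random then a ∈ P.succ h.last else a = σ.next j h := by
  unfold Strategy.stepMeasure
  split_ifs with hr
  · rw [PMF.toMeasure_apply_singleton _ _ (measurableSet_singleton _)]
    simp [PMF.uniformOfFinset_apply]
  · rw [Measure.dirac_apply' _ (measurableSet_singleton _)]
    rw [eq_comm (a := a), Set.indicator_apply]
    split_ifs with h <;> simpa using h

/-- There are only countably many pairs of a history and a next vertex, so all impossible steps can
be discarded at once. -/
theorem Strategy.ae_step : ∀ᵐ ω ∂σ.prob v, ω 0 = v ∧ ∀ j,
    σ.stepMeasure j (frestrictLe (π := fun _ => Fin n) j ω) {ω (j + 1)} ≠ 0 := by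
  refine Filter.Eventually.and ?_ (ae_all_iff.2 fun j => ?_)
  · have h : ∀ᵐ ω ∂σ.prob v, frestrictLe (π := fun _ => Fin n) 0 ω = fun _ => v :=
      (prob_compl_eq_zero_iff (measurableSet_eq_fun (measurable_frestrictLe _)
        measurable_const)).2 (σ.prob_history_zero v)
    filter_upwards [h] with ω hω
    exact congrFun hω ⟨0, by simp⟩
  · have h (h : History n j) (a : Fin n) (h0 : σ.stepMeasure j h {a} = 0) :
        ∀ᵐ ω ∂σ.prob v, ¬ (frestrictLe (π := fun _ => Fin n) j ω = h ∧ ω (j + 1) = a) := by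
      rw [ae_iff]
      simp only [not_not]
      rw [σ.prob_history_succ, h0, mul_zero]
    have h' : ∀ᵐ ω ∂σ.prob v, ∀ (h : History n j) (a : Fin n), σ.stepMeasure j h {a} = 0 →
        ¬ (frestrictLe (π := fun _ => Fin n) j ω = h ∧ ω (j + 1) = a) := by
      refine ae_all_iff.2 fun h' => ae_all_iff.2 fun a => ?_
      by_cases h0 : σ.stepMeasure j h' {a} = 0
      · filter_upwards [h h' a h0] with ω hω _ using hω
      · exact Filter.Eventually.of_forall fun ω h => absurd h h0
    filter_upwards [h'] with ω hω h0
    exact hω _ _ h0 ⟨rfl, rfl⟩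

/-- A strategy that keeps the play in `S` satisfies the safety objective of each target set that is
disjoint from `S`. -/
theorem Strategy.prob_safety (S : Set (Fin n)) (hv : v ∈ S)
    (hrandom : ∀ u ∈ S, u ∈ P.random → ∀ a ∈ P.succ u, a ∈ S)
    (hnext : ∀ j (h : History n j), h.last ∈ S → h.last ∉ P.random → σ.next j h ∈ S)
    (T : Finset (Fin n)) (hT : ∀ u ∈ S, u ∉ T) : σ.prob v (P.safety T) = 1 := by
  have h : ∀ᵐ ω ∂σ.prob v, ω ∈ P.safety T := by
    filter_upwards [σ.ae_step v] with ω ⟨h0, hω⟩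
    simp only [σ.stepMeasure_pos] at hω
    have hlast (j : ℕ) : History.last (frestrictLe (π := fun _ => Fin n) j ω) = ω j := rfl
    simp only [hlast] at hω
    have hS (j : ℕ) : ω j ∈ S := by
      induction j with
      | zero => rwa [h0]
      | succ j ih =>
        have := hω j
        split_ifs at this with hr
        · exact hrandom _ ih hr _ this
        · rw [this]; exact hnext j _ ih hr
    refine ⟨fun j => ?_, fun j => hT _ (hS j)⟩
    have := hω j
    split_ifs at this with hr
    · exact this
    · rw [this]; exact σ.next_mem j (frestrictLe (π := fun _ => Fin n) j ω) hr
  rw [measure_congr (Filter.eventuallyEq_univ.2 h : P.safety T =ᵐ[σ.prob v] Set.univ),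
    measure_univ]

/-- A history that is extended by one vertex. -/
def snoc {j : ℕ} (h : History n j) (a : Fin n) : History n (j + 1) := fun i =>
  if hi : i.1 ≤ j then h ⟨i.1, Finset.mem_Iic.2 hi⟩ else a

theorem last_snoc {j : ℕ} (h : History n j) (a : Fin n) : (snoc h a).last = a := by
  simp [History.last, snoc]

theorem frestrictLe_eq_snoc {j : ℕ} (h : History n j) (a : Fin n) (ω : ℕ → Fin n) :
    frestrictLe (π := fun _ => Fin n) (j + 1) ω = snoc h a ↔
      frestrictLe (π := fun _ => Fin n) j ω = h ∧ ω (j + 1) = a := by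
  constructor
  · intro hω
    refine ⟨funext fun i => ?_, ?_⟩
    · have := congrFun hω ⟨i.1, Finset.mem_Iic.2 ((Finset.mem_Iic.1 i.2).trans j.le_succ)⟩
      simpa [snoc, Finset.mem_Iic.1 i.2] using this
    · have := congrFun hω ⟨j + 1, Finset.mem_Iic.2 le_rfl⟩
      simpa [snoc] using this
  · rintro ⟨rfl, rfl⟩
    funext i
    have := Finset.mem_Iic.1 i.2
    by_cases hi : i.1 ≤ j
    · simp [snoc, hi]
    · have hi' : i.1 = j + 1 := by omega
      simp [snoc, hi, ← hi']

/-- With positive probability a play visits all vertices of a set that is closed under random moves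
and cannot be left by the strategy. -/
theorem Strategy.exists_closed : ∃ Z : Finset (Fin n), Z.Nonempty ∧
    (∀ u ∈ Z, u ∈ P.random → ∀ a ∈ P.succ u, a ∈ Z) ∧
    (∀ u ∈ Z, u ∉ P.random → ∃ a ∈ P.succ u, a ∈ Z) ∧
    σ.prob v {ω | ∀ a ∈ Z, ∃ i, ω i = a} ≠ 0 := by
  classical
  let Reach (j : ℕ) (h : History n j) : Prop :=
    σ.prob v {ω | frestrictLe (π := fun _ => Fin n) j ω = h} ≠ 0
  let visited (j : ℕ) (h : History n j) : Finset (Fin n) := Finset.univ.image h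
  have hstep (j : ℕ) (h : History n j) (a : Fin n) (hh : Reach j h)
      (ha : σ.stepMeasure j h {a} ≠ 0) : Reach (j + 1) (snoc h a) := by
    simp only [Reach, frestrictLe_eq_snoc, σ.prob_history_succ]
    exact mul_ne_zero hh ha
  -- Among the finitely many vertex sets visited by a history of positive probability, take a
  -- maximal one.
  obtain ⟨W, ⟨j₀, h₀, hr₀, rfl⟩, hmax⟩ := Set.Finite.exists_maximal
    (Set.toFinite {W | ∃ j h, Reach j h ∧ visited j h = W})
    ⟨_, 0, fun _ => v, by simp [Reach, σ.prob_history_zero], rfl⟩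
  -- By maximality, a possible step after a history that has visited this set cannot reach a new
  -- vertex.
  have hext (j : ℕ) (h : History n j) (a : Fin n) (hh : Reach j h)
      (hW : visited j h = visited j₀ h₀) (ha : σ.stepMeasure j h {a} ≠ 0) :
      Reach (j + 1) (snoc h a) ∧ visited (j + 1) (snoc h a) = visited j₀ h₀ := by
    have hr := hstep j h a hh ha
    refine ⟨hr, ?_⟩
    have hle : visited j₀ h₀ ⊆ visited (j + 1) (snoc h a) := by
      rw [← hW]
      intro u hu
      obtain ⟨i, -, rfl⟩ := Finset.mem_image.1 hu
      have hi := Finset.mem_Iic.1 i.2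
      exact Finset.mem_image.2 ⟨⟨i.1, Finset.mem_Iic.2 (hi.trans j.le_succ)⟩, Finset.mem_univ _,
        by simp [snoc, hi]⟩
    exact le_antisymm (hmax ⟨_, _, hr, rfl⟩ hle) hle
  -- The endpoints of all histories with this visited set. Possible steps preserve the property,
  -- which gives both closure conditions.
  let Z : Finset (Fin n) := Finset.univ.filter fun u =>
    ∃ j h, Reach j h ∧ visited j h = visited j₀ h₀ ∧ History.last h = u
  have hZ (u : Fin n) :
      u ∈ Z ↔ ∃ j h, Reach j h ∧ visited j h = visited j₀ h₀ ∧ History.last h = u := by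
    simp [Z]
  refine ⟨Z, ⟨_, (hZ _).2 ⟨j₀, h₀, hr₀, rfl, rfl⟩⟩, ?_, ?_, ?_⟩
  · intro u hu hr a ha
    obtain ⟨j, h, hh, hW, rfl⟩ := (hZ u).1 hu
    obtain ⟨h1, h2⟩ := hext j h a hh hW (σ.stepMeasure_pos.2 (by simpa [hr] using ha))
    exact (hZ a).2 ⟨_, _, h1, h2, last_snoc h a⟩
  · intro u hu hr
    obtain ⟨j, h, hh, hW, rfl⟩ := (hZ u).1 hu
    obtain ⟨h1, h2⟩ := hext j h (σ.next j h) hh hW (σ.stepMeasure_pos.2 (by simp [hr]))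
    exact ⟨_, σ.next_mem j h hr, (hZ _).2 ⟨_, _, h1, h2, last_snoc h _⟩⟩
  -- All plays that extend `h₀` have visited the maximal set, which contains `Z`.
  · refine fun h0 => hr₀ (measure_mono_null ?_ h0)
    rintro ω rfl a ha
    obtain ⟨j, h, hh, hW, rfl⟩ := (hZ a).1 ha
    have : History.last h ∈ visited j h := Finset.mem_image.2 ⟨_, Finset.mem_univ _, rfl⟩
    rw [hW] at this
    obtain ⟨i, -, hi⟩ := Finset.mem_image.1 this
    exact ⟨i.1, hi⟩

end MDP

/-- With the next lemma this places either winning set between those of the query and the objective,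
so a yes instance is treated only for the query and a no instance only for the objective. -/
theorem SafetyInstance.winningSet_query_subset (x : SafetyInstance) (D : Disjunction) :
    x.winningSet .query ⊆ x.winningSet D := by
  cases D with
  | query => exact subset_rfl
  | objective =>
    intro v hv
    simp only [winningSet, Set.mem_iUnion] at hv
    obtain ⟨T, hT, σ, hσ⟩ := hv
    refine ⟨σ, le_antisymm prob_le_one (hσ ▸ measure_mono ?_)⟩
    exact Set.subset_biUnion_of_mem (u := fun T => x.mdp.safety T) hT

theorem SafetyInstance.winningSet_subset_objective (x : SafetyInstance) (D : Disjunction) :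
    x.winningSet D ⊆ x.winningSet .objective := by
  cases D with
  | query => exact x.winningSet_query_subset _
  | objective => exact subset_rfl

/-! ### From orthogonal vectors to disjunctive safety: correctness -/

theorem sum_toNat_mul_toNat_eq_zero {d : ℕ} {u v : Fin d → Bool} :
    ∑ i, (u i).toNat * (v i).toNat = 0 ↔ ∀ i, u i = true → v i = false := by
  simp only [Finset.sum_eq_zero_iff, Finset.mem_univ, true_imp_iff, mul_eq_zero,
    Bool.toNat_eq_zero]
  refine forall_congr' fun i => ?_
  cases u i <;> simp

namespace OVInstance

variable (x : OVInstance)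

theorem vertexData_zero (h : 0 < x.vertexData.length) :
    x.vertexData[0] = (0, List.range' 1 (x.S₁.length + 1)) := rfl

theorem vertexData_vector (i : ℕ) (hi : i < x.S₁.length) (h : i + 1 < x.vertexData.length) :
    x.vertexData[i + 1] = (1, 0 :: rowCode (x.S₁.length + 2) 1 (List.ofFn x.S₁[i])) := by
  simp only [vertexData, List.cons_append, List.getElem_cons_succ]
  rw [List.getElem_append_left (by simpa using hi), List.getElem_map]

theorem vertexData_other (i : ℕ) (hi : x.S₁.length < i) (h : i < x.vertexData.length) :
    x.vertexData[i] = (0, [0]) := by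
  obtain ⟨i, rfl⟩ := Nat.exists_eq_add_of_lt hi
  simp only [vertexData, List.cons_append, List.getElem_cons_succ]
  rw [List.getElem_append_right (by simp), List.getElem_map]

/-- The start vertex. -/
def start : Fin x.vertexData.length := ⟨0, by simp [vertexData]⟩

theorem mem_succ {u v : Fin x.vertexData.length} :
    u ∈ x.toMDP.succ v ↔ u.val ∈ x.vertexData[v.val].2 := by simp [toMDP]

theorem mem_random {v : Fin x.vertexData.length} :
    v ∈ x.toMDP.random ↔ x.vertexData[v.val].1 = 1 := by simp [toMDP]

theorem mem_target {v : Fin x.d → Bool} {u : Fin x.vertexData.length} :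
    u ∈ x.target v ↔ u.val ∈ x.targetData v := by simp [target]

theorem winningSet_objective_eq_empty (hx : ¬ x.HasOrthogonalPair) :
    x.toSafety.winningSet .objective = ∅ := by
  rw [Set.eq_empty_iff_forall_notMem]
  rintro z ⟨σ, hσ⟩
  change x.toMDP.Strategy at σ
  change Fin x.vertexData.length at z
  change σ.prob z (⋃ T ∈ x.S₂.map x.target, x.toMDP.safety T) = 1 at hσ
  obtain ⟨Z, ⟨u, hu⟩, hrandom, hplayer, hpos⟩ := σ.exists_closed z
  have hlen := x.length_vertexData
  -- Vector vertices are random with the start among their successors, and the vertices after them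
  -- have no other successor, so closure forces the start into `Z`.
  have h0 : x.start ∈ Z := by
    rcases Nat.lt_or_ge x.S₁.length u.val with h | h
    · obtain ⟨a, ha, haZ⟩ := hplayer u hu (by
        rw [x.mem_random, x.vertexData_other _ h]; simp)
      rw [x.mem_succ, x.vertexData_other _ h, List.mem_singleton] at ha
      rwa [show x.start = a from Fin.ext ha.symm]
    · rcases Nat.eq_zero_or_pos u.val with h' | h'
      · rwa [show x.start = u from Fin.ext h'.symm]
      · obtain ⟨i, hi⟩ := Nat.exists_eq_add_of_le' h'
        have hd : x.vertexData[u.val] = _ :=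
          (List.getElem_of_eq rfl _).trans ((getElem_congr_idx hi).trans
            (x.vertexData_vector i (by omega) (by omega)))
        refine hrandom u hu (by rw [x.mem_random, hd]) _ ?_
        rw [x.mem_succ, hd]
        exact List.mem_cons_self
  -- Some successor of the start is in `Z`. It is either the vertex that all targets contain, or a
  -- vector vertex; the latter brings all its successors along, among them the vertex of a
  -- coordinate where both vectors have a 1.
  have hmeet (v) (hv : v ∈ x.S₂) : ∃ a ∈ Z, a ∈ x.target v := by
    obtain ⟨a, ha, haZ⟩ := hplayer x.start h0 (by
      rw [x.mem_random]; exact zero_ne_one)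
    rw [x.mem_succ] at ha
    change a.val ∈ List.range' 1 (x.S₁.length + 1) at ha
    rw [List.mem_range'_1] at ha
    rcases Nat.lt_or_ge x.S₁.length a.val with h | h
    · refine ⟨a, haZ, ?_⟩
      have : a.val = x.S₁.length + 1 := by omega
      rw [x.mem_target, this]
      exact List.mem_cons_self
    · obtain ⟨i, hi⟩ := Nat.exists_eq_add_of_le' ha.1
      have hd : x.vertexData[a.val] = _ :=
        (getElem_congr_idx hi).trans (x.vertexData_vector i (by omega) (by omega))
      obtain ⟨j, hj, hj'⟩ : ∃ j, x.S₁[i] j = true ∧ v j = true := by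
        by_contra! hne
        exact hx ⟨x.S₁[i], List.getElem_mem _, v, hv, sum_toNat_mul_toNat_eq_zero.2 fun j hj => by
          simpa using hne j hj⟩
      let b : Fin x.vertexData.length := ⟨x.S₁.length + 2 + 3 * j, by have := j.isLt; omega⟩
      refine ⟨b, hrandom a haZ (by rw [x.mem_random, hd]) b ?_, ?_⟩
      · rw [x.mem_succ, hd]
        exact List.mem_cons_of_mem _ (mem_rowCode.2 ⟨j, by simp, by simp [hj, b]⟩)
      · exact x.mem_target.2 (List.mem_cons_of_mem _ (mem_rowCode.2
          ⟨j, by simp only [List.length_ofFn]; exact j.isLt, by simp [hj', b]⟩))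
  set A : Set (ℕ → Fin x.vertexData.length) := {ω | ∀ a ∈ Z, ∃ i, ω i = a} with hA
  have hAm : MeasurableSet A := by
    have : A = ⋂ a ∈ Z, ⋃ i, {ω | ω i = a} := by ext; simp [hA]
    rw [this]
    exact Finset.measurableSet_biInter _ fun a _ => MeasurableSet.iUnion fun i =>
      measurableSet_eq_fun (measurable_pi_apply i) measurable_const
  have hsub : (⋃ T ∈ x.S₂.map x.target, x.toMDP.safety T) ⊆ Aᶜ := by
    intro ω hω hωA
    simp only [Set.mem_iUnion, List.mem_map] at hω
    obtain ⟨_, ⟨v, hv, rfl⟩, -, hω⟩ := hω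
    obtain ⟨a, haZ, haT⟩ := hmeet v hv
    obtain ⟨i, rfl⟩ := hωA a haZ
    exact hω i haT
  have h1 : σ.prob z Aᶜ = 1 := le_antisymm prob_le_one (hσ ▸ measure_mono hsub)
  exact hpos ((prob_compl_eq_one_iff hAm).1 h1)

theorem start_mem_winningSet_query (hx : x.HasOrthogonalPair) :
    x.start ∈ x.toSafety.winningSet .query := by
  obtain ⟨u, hu, v, hv, h⟩ := hx
  rw [sum_toNat_mul_toNat_eq_zero] at h
  obtain ⟨i, hi, rfl⟩ := List.getElem_of_mem hu
  have hlen := x.length_vertexData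
  change x.start ∈ ⋃ T ∈ x.S₂.map x.target, x.toMDP.almostSure (x.toMDP.safety T)
  refine Set.mem_iUnion₂.2 ⟨x.target v, List.mem_map_of_mem hv, ?_⟩
  let a : Fin x.vertexData.length := ⟨i + 1, by omega⟩
  have ha : x.vertexData[a.val] = _ := x.vertexData_vector i hi a.isLt
  -- The memoryless strategy that always picks the vertex of the orthogonal vector `u`.
  let σ : x.toMDP.Strategy :=
    { next := fun j h => if h.last = x.start then a else x.start
      next_mem := fun j h hh => by
        rw [x.mem_succ]
        split_ifs with h0
        · rw [h0]
          change a.val ∈ List.range' 1 (x.S₁.length + 1)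
          rw [List.mem_range'_1]
          simp only [a]; omega
        · rw [x.mem_random] at hh
          have hpos : 1 ≤ h.last.val := Nat.one_le_iff_ne_zero.2 fun hz => h0 (Fin.ext hz)
          rcases Nat.lt_or_ge x.S₁.length h.last.val with hl | hl
          · rw [x.vertexData_other _ hl]
            exact List.mem_singleton.2 rfl
          · obtain ⟨k, hk⟩ := Nat.exists_eq_add_of_le' hpos
            have hd : x.vertexData[h.last.val] = _ :=
              (getElem_congr_idx hk).trans (x.vertexData_vector k (by omega) (by omega))
            rw [hd] at hh
            exact absurd rfl hh }
  refine ⟨σ, σ.prob_safety _ ({x.start, a} ∪ {b | b ∈ x.toMDP.succ a}) (Or.inl (Or.inl rfl)) ?_ ?_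
    _ ?_⟩
  · intro b hb hr c hc
    rcases hb with (rfl | hb) | hb
    · exact absurd ((x.mem_random).1 hr) zero_ne_one
    · rw [Set.mem_singleton_iff] at hb
      subst hb
      exact Or.inr hc
    · change b ∈ x.toMDP.succ a at hb
      rw [x.mem_succ, ha, List.mem_cons] at hb
      rcases hb with hb | hb
      · have : x.vertexData[b.val] = _ :=
          (getElem_congr_idx hb).trans (x.vertexData_zero (by omega))
        rw [x.mem_random, this] at hr
        exact absurd hr zero_ne_one
      · have := x.rowCode_lt (by simp) _ hb
        rw [x.mem_random, x.vertexData_other _ (by omega)] at hr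
        exact absurd hr zero_ne_one
  · intro j h _ _
    change (if h.last = x.start then a else x.start) ∈ _
    split_ifs
    · exact Or.inl (Or.inr rfl)
    · exact Or.inl (Or.inl rfl)
  · intro b hb hbT
    rw [x.mem_target, targetData, List.mem_cons] at hbT
    have hb1 : x.S₁.length + 1 ≤ b.val := by
      rcases hbT with h | h
      · omega
      · have := x.rowCode_lt le_rfl _ h; omega
    rcases hb with (rfl | hb) | hb
    · exact absurd hb1 (by simp [start])
    · rw [Set.mem_singleton_iff] at hb
      subst hb
      simp only [a] at hb1
      omega
    · change b ∈ x.toMDP.succ a at hb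
      rw [x.mem_succ, ha, List.mem_cons] at hb
      rcases hb with hb | hb
      · omega
      · obtain ⟨j, hj, hj1⟩ := mem_rowCode.1 hb
        have hlt := x.rowCode_lt (by simp) _ hb
        rcases hbT with hbT | hbT
        · omega
        · obtain ⟨j', hj', hj2⟩ := mem_rowCode.1 hbT
          have h1 := ((List.ofFn x.S₁[i])[j]).not.toNat_le
          have h2 := ((List.ofFn v)[j']).not.toNat_le
          -- The offsets within a triple are 0 or 1 for successors and 0 or 2 for targets; equal
          -- numbers force the same coordinate and offset 0 twice, so both bits are 1.
          obtain rfl : j = j' := by omega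
          have h3 : (!(List.ofFn x.S₁[i])[j]).toNat = 0 := by omega
          have h4 : (!(List.ofFn v)[j]).toNat = 0 := by omega
          rw [Bool.toNat_eq_zero, Bool.not_eq_false', List.getElem_ofFn] at h3 h4
          have := h _ h3
          rw [h4] at this
          exact Bool.noConfusion this

end OVInstance

/-! ### The running times -/

theorem Problem.SolvableInTime.restrict {A B : Problem} {TA : A.Inst → ℝ} {TB : B.Inst → ℝ}
    (hB : B.SolvableInTime TB) (f : A.Inst → B.Inst) (hencode : ∀ x, B.encode (f x) = A.encode x)
    (hcorrect : ∀ x mem, B.Correct (f x) mem → A.Correct x mem) (hT : ∀ x, TB (f x) ≤ TA x) :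
    A.SolvableInTime TA := by
  have h0 := hB.nonneg
  obtain ⟨P, c, hP⟩ := hB
  refine ⟨P, c, fun x w hw hx => ?_⟩
  obtain ⟨t, mem, ht, hh, hC⟩ := hP (f x) w (le_trans (pow_le_pow_left₀
    (by have := h0 (f x); positivity) (by
      rw [Problem.length, hencode]; exact add_le_add_right (hT x) _) c) hw)
    (by rwa [hencode])
  exact ⟨t, mem, ht.trans (hT x), hencode x ▸ hh, hcorrect x mem hC⟩

/-- The orthogonal vectors problem in arbitrary dimension. -/
def orthogonalVectors : Problem where
  Inst := OVInstance
  encode x := x.encode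
  Correct x := DecisionAnswer x.HasOrthogonalPair

/-- The time bound `(d + 1) ^ 2 (N + 1) ^ (2 - ε)`. -/
def ovTime (ε : ℝ) (x : OVInstance) : ℝ := ((x.d : ℝ) + 1) ^ 2 * ((x.N : ℝ) + 1) ^ (2 - ε)

theorem le_ovTime {ε : ℝ} (hε : ε ≤ 1) (x : OVInstance) :
    ((x.d : ℝ) + 1) * ((x.N : ℝ) + 1) ≤ ovTime ε x := by
  have h1 : (1 : ℝ) ≤ (x.d : ℝ) + 1 := by simp
  have h2 : (1 : ℝ) ≤ (x.N : ℝ) + 1 := by simp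
  refine mul_le_mul (le_self_pow₀ h1 two_ne_zero) ?_ (by positivity) (by positivity)
  exact Real.self_le_rpow_of_one_le h2 (by linarith)

theorem length_ovEncode (x : OVInstance) :
    x.encode.length = (x.S₁.length + x.S₂.length) * x.d + 3 := by
  rw [x.encode_eq, List.length_cons, List.length_cons, List.length_cons,
    length_flatMap (d := x.d) (by simp [or_imp, forall_and]) _ 0 (by simp)]
  simp

theorem length_safetyEncode (x : OVInstance) : x.toSafety.encode.length =
    x.S₁.length + 5 + x.S₁.length * (x.d + 3) + (3 * x.d + 1) * 3 + x.S₂.length * (x.d + 2) := by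
  have := length_safetyCode (d := x.d) (x.S₁.map List.ofFn) (x.S₂.map List.ofFn) (by simp) (by simp)
  rw [x.toSafety_encode]
  simpa using this

theorem length_safetyEncode_le (x : OVInstance) :
    x.toSafety.encode.length ≤ 24 * ((x.d + 1) * (x.N + 1)) := by
  have h1 : x.S₁.length ≤ x.N := le_max_left _ _
  have h2 : x.S₂.length ≤ x.N := le_max_right _ _
  rw [length_safetyEncode]
  have h3 := Nat.mul_le_mul_right (x.d + 3) h1
  have h4 := Nat.mul_le_mul_right (x.d + 2) h2
  nlinarith

theorem le_of_mem_safetyCode {d N₁ N₂ a : ℕ} {us vs : List (List Bool)}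
    (hus : ∀ u ∈ us, u.length = d) (hvs : ∀ v ∈ vs, v.length = d)
    (ha : a ∈ safetyCode d N₁ N₂ us vs) : a ≤ N₁ + 2 + 3 * d + N₂ := by
  have hrow {k : ℕ} (hk : k ≤ 2) {u : List Bool} (hu : u.length = d)
      (h : a ∈ rowCode (N₁ + 2) k u) : a ≤ N₁ + 2 + 3 * d + N₂ := by
    obtain ⟨j, hj, rfl⟩ := mem_rowCode.1 h
    have : k * (!u[j]).toNat ≤ 2 * 1 := Nat.mul_le_mul hk (Bool.toNat_le _)
    omega
  simp only [safetyCode, List.cons_append, List.mem_cons, List.mem_append, List.mem_flatMap,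
    List.mem_range'_1, List.not_mem_nil, or_false, List.append_assoc] at ha
  rcases ha with h | h | h | h | ⟨u, hu, h | h | h | h⟩ | ⟨_, _, h⟩ | h | ⟨v, hv, h | h | h⟩
  any_goals omega
  · exact hrow (by simp) (hus u hu) h
  · exact hrow le_rfl (hvs v hv) h

/-- A problem to which orthogonal vectors reduces by means of the disjunctive safety instances. -/
theorem orthogonalVectors_solvable {B : Problem} {TB : B.Inst → ℝ} (hB : B.SolvableInTime TB)
    (f : OVInstance → B.Inst) (b : Bool)
    (hencode : ∀ x, B.encode (f x) = (if b then [0] else []) ++ x.toSafety.encode)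
    (hcorrect : ∀ x mem, B.Correct (f x) mem → DecisionAnswer x.HasOrthogonalPair mem)
    {ε K : ℝ} (hε : ε ≤ 1) (hT : ∀ x, TB (f x) ≤ K * ovTime ε x) :
    orthogonalVectors.SolvableInBigO (ovTime ε) := by
  have htransforms (x : OVInstance) (w : ℕ)
      (hlen : x.encode.length + (B.encode (f x)).length + 1 < 2 ^ w) :
      Transforms w ovLength (ovCmd b) x.encode (B.encode (f x))
        (100 * (x.S₁.length + x.S₂.length + 1) * (x.d + 1)) ∧
      ∀ a ∈ B.encode (f x), a < 2 ^ w := by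
    rw [hencode, List.length_append, x.toSafety_encode] at hlen
    have hcode := length_safetyEncode x
    rw [x.toSafety_encode] at hcode
    have h1 := Nat.zero_le (x.S₁.length * (x.d + 3))
    have h2 : x.S₂.length ≤ x.S₂.length * (x.d + 2) := Nat.le_mul_of_pos_right _ (by omega)
    constructor
    · rw [hencode, x.toSafety_encode]
      have := ovCmd_exec (w := w) (d := x.d) b (x.S₁.map List.ofFn) (x.S₂.map List.ofFn) (by simp)
        (by simp) (by rw [List.length_map]; omega) (x := x.encode)
        (by rw [List.length_map, List.length_map]; exact x.encode_eq)
        (by rw [List.length_map, List.length_map]; omega)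
      simpa only [List.length_map] using this
    · intro a ha
      rw [hencode, x.toSafety_encode, List.mem_append] at ha
      rcases ha with ha | ha
      · have : a = 0 := by cases b <;> simp at ha; exact ha
        rw [this]; positivity
      · have := le_of_mem_safetyCode (by simp) (by simp) ha
        omega
  -- In units of `(d + 1) (N + 1)` the overhead is at most 200 + 6 (3 + 25) + 28 = 396.
  have htime (x : OVInstance) : ((100 * (x.S₁.length + x.S₂.length + 1) * (x.d + 1) : ℕ) : ℝ) +
      6 * (x.encode.length + (B.encode (f x)).length) + 28 + TB (f x) ≤
        (K + 500) * ovTime ε x := by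
    have h1 : x.S₁.length ≤ x.N := le_max_left _ _
    have h2 : x.S₂.length ≤ x.N := le_max_right _ _
    have hs := le_ovTime hε x
    have h3 : x.encode.length ≤ 3 * ((x.d + 1) * (x.N + 1)) := by
      rw [length_ovEncode]
      have := Nat.mul_le_mul_right x.d (Nat.add_le_add h1 h2)
      nlinarith
    have h4 : (B.encode (f x)).length ≤ 25 * ((x.d + 1) * (x.N + 1)) := by
      rw [hencode, List.length_append]
      have := length_safetyEncode_le x
      have h5 : 1 ≤ (x.d + 1) * (x.N + 1) := Nat.one_le_iff_ne_zero.2 (by positivity)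
      have : (if b then [0] else []).length ≤ 1 := by cases b <;> simp
      omega
    have h5 : 100 * (x.S₁.length + x.S₂.length + 1) * (x.d + 1) ≤
        200 * ((x.d + 1) * (x.N + 1)) := by
      calc 100 * (x.S₁.length + x.S₂.length + 1) * (x.d + 1)
          ≤ 100 * (2 * (x.N + 1)) * (x.d + 1) := by gcongr; omega
        _ = 200 * ((x.d + 1) * (x.N + 1)) := by ring
    have h6 : (1 : ℝ) ≤ ((x.d : ℝ) + 1) * ((x.N : ℝ) + 1) := by
      have h7 : (0 : ℝ) ≤ x.d := by positivity
      have h8 : (0 : ℝ) ≤ x.N := by positivity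
      nlinarith [mul_nonneg h7 h8]
    have h3' : (x.encode.length : ℝ) ≤ 3 * (((x.d : ℝ) + 1) * ((x.N : ℝ) + 1)) := by
      simpa using (Nat.cast_le (α := ℝ)).2 h3
    have h4' : ((B.encode (f x)).length : ℝ) ≤ 25 * (((x.d : ℝ) + 1) * ((x.N : ℝ) + 1)) := by
      simpa using (Nat.cast_le (α := ℝ)).2 h4
    have h5' : ((100 * (x.S₁.length + x.S₂.length + 1) * (x.d + 1) : ℕ) : ℝ) ≤
        200 * (((x.d : ℝ) + 1) * ((x.N : ℝ) + 1)) := by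
      simpa using (Nat.cast_le (α := ℝ)).2 h5
    have := hT x
    rw [add_mul]
    linarith
  exact ⟨K + 500, hB.reduce (A := orthogonalVectors) f ovLength (ovCmd b)
    (by simp [ovLength, Cmd.EmitFree, Basic.EmitFree]) hcorrect 0 _
    (fun x w _ _ => htransforms x w) htime⟩

/-- Fast algorithms for orthogonal vectors contradict the conjecture. -/
theorem not_OVC_of_solvable {ε : ℝ} (hε : 0 < ε)
    (h : orthogonalVectors.SolvableInBigO (ovTime ε)) : ¬ OVC := by
  intro hOVC
  obtain ⟨c, hc⟩ := hOVC (ε / 2) (by positivity)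
  obtain ⟨C, h⟩ := h
  -- The factor `(d + 1) ^ 2` will cost `(N + 1) ^ (2 δ)`, which is half of the saving `ε`.
  set δ := ε / 4 with hδ
  have hδ0 : 0 < δ := by positivity
  set L : ℝ := c * (2 / δ) + 1 with hL
  refine hc ⟨|C| * L ^ 2, h.restrict (A := OVProblem c) Subtype.val (fun _ => rfl) (fun _ _ => id)
    fun x => ?_⟩
  obtain ⟨x, hx⟩ := x
  have hN : (1 : ℝ) ≤ (x.N : ℝ) + 1 := by simp
  have hp : (1 : ℝ) ≤ ((x.N : ℝ) + 1) ^ δ := Real.one_le_rpow hN hδ0.le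
  -- The factor 2 converts to the natural logarithm, as `log 2 > 1 / 2`; the factor `1 / δ` comes
  -- from `log y ≤ y ^ δ / δ`.
  have hlog : (Nat.log 2 x.N : ℝ) ≤ (2 / δ) * ((x.N : ℝ) + 1) ^ δ := by
    rcases Nat.eq_zero_or_pos x.N with h0 | h0
    · rw [h0]; simp; positivity
    have h1 : ((2 : ℝ) ^ Nat.log 2 x.N) ≤ (x.N : ℝ) + 1 := by
      have : 2 ^ Nat.log 2 x.N ≤ x.N + 1 := (Nat.pow_log_le_self 2 h0.ne').trans (Nat.le_succ _)
      exact_mod_cast this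
    have h2 := Real.log_le_log (by positivity) h1
    rw [Real.log_pow] at h2
    have h3 := Real.log_le_rpow_div (by positivity : (0 : ℝ) ≤ (x.N : ℝ) + 1) hδ0
    have h4 := Real.log_two_gt_d9
    have h5 : (0 : ℝ) ≤ Nat.log 2 x.N := by positivity
    have h6 : (2 / δ) * ((x.N : ℝ) + 1) ^ δ = 2 * (((x.N : ℝ) + 1) ^ δ / δ) := by ring
    rw [h6]
    nlinarith
  have hd : (x.d : ℝ) + 1 ≤ L * ((x.N : ℝ) + 1) ^ δ := by
    have h1 : (x.d : ℝ) ≤ c * Nat.log 2 x.N := by exact_mod_cast hx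
    have h2 := mul_le_mul_of_nonneg_left hlog (Nat.cast_nonneg c : (0 : ℝ) ≤ c)
    rw [hL]
    nlinarith
  have hL0 : 0 ≤ L := by positivity
  calc C * ovTime ε x ≤ |C| * ovTime ε x :=
        mul_le_mul_of_nonneg_right (le_abs_self C) (by unfold ovTime; positivity)
    _ ≤ |C| * ((L * ((x.N : ℝ) + 1) ^ δ) ^ 2 * ((x.N : ℝ) + 1) ^ (2 - ε)) := by
        unfold ovTime; gcongr
    _ = |C| * L ^ 2 * ((x.N : ℝ) + 1) ^ (2 - ε / 2) := by
        rw [mul_pow, ← Real.rpow_natCast (((x.N : ℝ) + 1) ^ δ) 2, ← Real.rpow_mul (by positivity),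
          mul_assoc (L ^ 2), ← Real.rpow_add (by positivity), mul_assoc]
        congr 3
        rw [hδ]; push_cast; ring

theorem CNF.length_encode_le {k : ℕ} (φ : CNF) (hk : ∀ C ∈ φ.clauses, C.length ≤ k) :
    φ.encode.length ≤ 2 + φ.m * (k + 1) := by
  have h : (φ.clauses.flatMap fun C =>
      C.length :: C.map fun l => 2 * l.1.val + l.2.toNat).length ≤ φ.clauses.length * (k + 1) := by
    rw [List.length_flatMap]
    refine (List.sum_le_card_nsmul _ (k + 1) ?_).trans (by simp)
    simpa using hk
  rw [encode, m, List.length_append]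
  simpa using h

theorem CNF.toOV_N (φ : CNF) : φ.toOV.N = 2 ^ φ.half := by simp [OVInstance.N, CNF.toOV]

theorem CNF.toOV_d (φ : CNF) : φ.toOV.d = φ.m := by simp [CNF.toOV, CNF.natClauses, CNF.m]

theorem CNF.length_toOV_encode (φ : CNF) : φ.toOV.encode.length = 2 * 2 ^ φ.half * φ.m + 3 := by
  have h1 : φ.toOV.S₁.length = 2 ^ φ.half := by simp [toOV]
  have h2 : φ.toOV.S₂.length = 2 ^ φ.half := by simp [toOV]
  rw [length_ovEncode, h1, h2, φ.toOV_d, two_mul]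

/-- Rounding up the half and the summand 1 replace `n / 2` by at most `(n + 3) / 2` in the exponent,
which costs a factor of at most 2³. -/
theorem CNF.rpow_half_le (φ : CNF) {ε : ℝ} (hε0 : 0 ≤ ε) (hε : ε ≤ 1) :
    ((2 : ℝ) ^ φ.half + 1) ^ (2 - ε) ≤ 8 * 2 ^ ((1 - ε / 2) * (φ.n : ℝ)) := by
  have h1 : (2 : ℝ) ^ φ.half + 1 ≤ 2 ^ (((φ.n : ℝ) + 3) / 2) := by
    have h2 : (1 : ℝ) ≤ 2 ^ φ.half := one_le_pow₀ one_le_two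
    calc (2 : ℝ) ^ φ.half + 1 ≤ 2 ^ (φ.half + 1) := by rw [pow_succ]; linarith
      _ = 2 ^ ((φ.half + 1 : ℕ) : ℝ) := (Real.rpow_natCast _ _).symm
      _ ≤ 2 ^ (((φ.n : ℝ) + 3) / 2) := by
        refine Real.rpow_le_rpow_of_exponent_le one_le_two ?_
        have : 2 * (φ.half + 1) ≤ φ.n + 3 := by unfold CNF.half; omega
        have : (2 : ℝ) * ((φ.half + 1 : ℕ) : ℝ) ≤ (φ.n : ℝ) + 3 := by exact_mod_cast this
        linarith
  calc ((2 : ℝ) ^ φ.half + 1) ^ (2 - ε) ≤ (2 ^ (((φ.n : ℝ) + 3) / 2)) ^ (2 - ε) :=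
        Real.rpow_le_rpow (by positivity) h1 (by linarith)
    _ = 2 ^ (((φ.n : ℝ) + 3) / 2 * (2 - ε)) := (Real.rpow_mul zero_le_two _ _).symm
    _ ≤ 2 ^ (3 + (1 - ε / 2) * (φ.n : ℝ)) := by
        refine Real.rpow_le_rpow_of_exponent_le one_le_two ?_
        nlinarith
    _ = 8 * 2 ^ ((1 - ε / 2) * (φ.n : ℝ)) := by
        rw [Real.rpow_add two_pos]; norm_num

theorem CNF.transforms_toOV {k : ℕ} (φ : CNF) (hk : ∀ C ∈ φ.clauses, C.length ≤ k) {w : ℕ}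
    (hn : φ.n + 2 < w) (hw : ∀ a ∈ φ.encode, a < 2 ^ w)
    (hlen : φ.encode.length + φ.toOV.encode.length + 1 < 2 ^ w) :
    Transforms w satLength satCmd φ.encode φ.toOV.encode
      (100 * (k + 1) * (φ.m + 1) * 2 ^ φ.half) ∧ ∀ a ∈ φ.toOV.encode, a < 2 ^ w := by
  have hm : φ.natClauses.length = φ.m := by simp [natClauses, m]
  rw [φ.encode_eq, List.forall_mem_cons, List.forall_mem_cons] at hw
  have hC (C) (hC : C ∈ φ.natClauses) (l) (hl : l ∈ C) : 2 * l.1 + l.2.toNat < 2 ^ w :=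
    hw.2.2 _ (List.mem_flatMap.2 ⟨C, hC, List.mem_cons_of_mem _ (List.mem_map_of_mem hl)⟩)
  have hk' (C) (hC : C ∈ φ.natClauses) : C.length ≤ k := by
    obtain ⟨C, h, rfl⟩ := List.mem_map.1 hC
    simpa using hk C h
  constructor
  · have := satCmd_exec φ.natClauses hk' hn φ.encode_eq (by omega) hw.2.1 hC
    rw [hm] at this
    rw [φ.toOV_encode]
    exact this
  · have h1 : 2 ^ φ.half < 2 ^ w := pow_lt_pow_right₀ one_lt_two (by unfold half; omega)
    rw [OVInstance.encode_eq]
    simp only [List.mem_cons, List.mem_flatMap, List.mem_map]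
    rintro a (rfl | rfl | rfl | ⟨_, _, b, _, rfl⟩)
    · exact hw.2.1
    · simpa [toOV] using h1
    · simpa [toOV] using h1
    · exact (Bool.toNat_le _).trans_lt (Nat.one_lt_two_pow (by omega))

/-- The time bound `K 2 ^ ((1 - ε / 2) n) (m + 1) ^ 2`. -/
def satTime (K ε : ℝ) (φ : CNF) : ℝ :=
  K * (2 ^ ((1 - ε / 2) * (φ.n : ℝ)) * ((φ.m : ℝ) + 1) ^ 2)

theorem CNF.rpow_le_satTime (φ : CNF) {K ε : ℝ} (hK : 1 ≤ K) (hε : ε ≤ 1) :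
    2 ^ ((φ.n : ℝ) / 2) ≤ satTime K ε φ := by
  have h1 : (2 : ℝ) ^ ((φ.n : ℝ) / 2) ≤ 2 ^ ((1 - ε / 2) * (φ.n : ℝ)) := by
    refine Real.rpow_le_rpow_of_exponent_le one_le_two ?_
    have : (0 : ℝ) ≤ φ.n := Nat.cast_nonneg _
    nlinarith
  have h2 : (1 : ℝ) ≤ ((φ.m : ℝ) + 1) ^ 2 := one_le_pow₀ (by simp)
  have h3 : (0 : ℝ) ≤ 2 ^ ((1 - ε / 2) * (φ.n : ℝ)) := by positivity
  have h4 := le_mul_of_one_le_right h3 h2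
  exact h1.trans (h4.trans (le_mul_of_one_le_left (h3.trans h4) hK))

/-- Why the exponent is 5: two factors, each at least `2 ^ (n / 2)`, give `2 ^ n`, and three
factors, each at least 2, give the additional `2 ^ 3`. -/
theorem CNF.lt_wordLength (φ : CNF) {K ε : ℝ} (hK : 1 ≤ K) (hε : ε ≤ 1) {w : ℕ}
    (hw : (2 + φ.encode.length + satTime K ε φ) ^ 5 ≤ 2 ^ w) : φ.n + 2 < w := by
  have h1 := φ.rpow_le_satTime hK hε
  have h2 : (0 : ℝ) ≤ φ.encode.length := Nat.cast_nonneg _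
  have h3 : (0 : ℝ) ≤ 2 ^ ((φ.n : ℝ) / 2) := by positivity
  have h4 : (2 : ℝ) ^ (φ.n + 3) ≤ 2 ^ w := by
    refine le_trans ?_ hw
    calc (2 : ℝ) ^ (φ.n + 3) = (2 ^ ((φ.n : ℝ) / 2)) ^ 2 * 2 ^ 3 := by
          rw [pow_add, ← Real.rpow_natCast (2 ^ ((φ.n : ℝ) / 2)), ← Real.rpow_mul zero_le_two,
            ← Real.rpow_natCast]
          congr 2
          simp
      _ ≤ (2 + φ.encode.length + satTime K ε φ) ^ 2 *
            (2 + φ.encode.length + satTime K ε φ) ^ 3 := by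
          gcongr <;> linarith
      _ = _ := by ring
  have := (pow_le_pow_iff_right₀ (one_lt_two (α := ℝ))).1 h4
  omega

theorem CNF.toOV_time_le {k : ℕ} (φ : CNF) (hk : ∀ C ∈ φ.clauses, C.length ≤ k) {ε : ℝ}
    (hε0 : 0 ≤ ε) (hε : ε ≤ 1) (C : ℝ) :
    ((100 * (k + 1) * (φ.m + 1) * 2 ^ φ.half : ℕ) : ℝ) +
      6 * (φ.encode.length + φ.toOV.encode.length) + 28 + C * ovTime ε φ.toOV ≤
        satTime (1000 * (k + 1) + 8 * |C|) ε φ := by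
  have h1 := φ.rpow_half_le hε0 hε
  have h2 : (φ.encode.length : ℝ) ≤ 2 + φ.m * (k + 1) := by
    exact_mod_cast φ.length_encode_le hk
  have h3 : (1 : ℝ) ≤ 2 ^ ((1 - ε / 2) * (φ.n : ℝ)) :=
    Real.one_le_rpow one_le_two (mul_nonneg (by linarith) (Nat.cast_nonneg _))
  have h4 : (2 : ℝ) ^ φ.half ≤ ((2 : ℝ) ^ φ.half + 1) ^ (2 - ε) :=
    (le_add_of_nonneg_right zero_le_one).trans
      (Real.self_le_rpow_of_one_le (by simp) (by linarith))
  have hH : (0 : ℝ) ≤ 2 ^ φ.half := by positivity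
  rw [satTime, ovTime, φ.toOV_N, φ.toOV_d, φ.length_toOV_encode]
  push_cast
  generalize (2 : ℝ) ^ ((1 - ε / 2) * (φ.n : ℝ)) = E at *
  generalize ((2 : ℝ) ^ φ.half + 1) ^ (2 - ε) = G at *
  generalize (2 : ℝ) ^ φ.half = H at *
  generalize (φ.encode.length : ℝ) = ℓ at *
  have hm : (0 : ℝ) ≤ φ.m := Nat.cast_nonneg _
  have hk : (0 : ℝ) ≤ k := Nat.cast_nonneg _
  generalize (φ.m : ℝ) = m at *
  generalize (k : ℝ) = κ at *
  have hE : 0 ≤ E := by linarith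
  have hM : m + 1 ≤ (m + 1) ^ 2 := le_self_pow₀ (by linarith) two_ne_zero
  have hME : (m + 1) ^ 2 ≤ E * (m + 1) ^ 2 := le_mul_of_one_le_left (by positivity) h3
  have t1 : 100 * (κ + 1) * (m + 1) * H ≤ 800 * (κ + 1) * (E * (m + 1) ^ 2) := by
    calc 100 * (κ + 1) * (m + 1) * H ≤ 100 * (κ + 1) * (m + 1) ^ 2 * (8 * E) := by
          gcongr; exact h4.trans h1
      _ = _ := by ring
  have t2 : 2 + m * (κ + 1) ≤ 2 * (κ + 1) * (E * (m + 1) ^ 2) := by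
    calc 2 + m * (κ + 1) ≤ 2 * (κ + 1) * (m + 1) := by nlinarith [mul_nonneg hm hk]
      _ ≤ _ := by gcongr; exact hM.trans hME
  have t3 : 2 * H * m ≤ 16 * (E * (m + 1) ^ 2) := by
    calc 2 * H * m ≤ 2 * (8 * E) * (m + 1) ^ 2 := by
          gcongr
          · exact h4.trans h1
          · linarith
      _ = _ := by ring
  have t4 : C * ((m + 1) ^ 2 * G) ≤ 8 * |C| * (E * (m + 1) ^ 2) := by
    calc C * ((m + 1) ^ 2 * G) ≤ |C| * ((m + 1) ^ 2 * (8 * E)) := by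
          have := hH.trans h4
          gcongr
          exact le_abs_self C
      _ = _ := by ring
  have hκ : 0 ≤ κ * (E * (m + 1) ^ 2) := by positivity
  have hX : 1 ≤ E * (m + 1) ^ 2 := by linarith
  generalize E * (m + 1) ^ 2 = X at *
  nlinarith

/-- Fast algorithms for orthogonal vectors contradict the strong exponential time hypothesis. -/
theorem not_SETH_of_solvable {ε : ℝ} (hε0 : 0 < ε) (hε : ε ≤ 1)
    (h : orthogonalVectors.SolvableInBigO (ovTime ε)) : ¬ SETH := by
  intro hSETH
  obtain ⟨k, hk⟩ := hSETH (ε / 2) (by positivity)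
  obtain ⟨C, h⟩ := h
  have hK : (1 : ℝ) ≤ 1000 * (k + 1) + 8 * |C| := by
    have := abs_nonneg C
    have : (0 : ℝ) ≤ k := Nat.cast_nonneg _
    linarith
  have key : (kSATProblem k).SolvableInTime fun φ => satTime (1000 * (k + 1) + 8 * |C|) ε φ.1 :=
    h.reduce (A := kSATProblem k) (fun φ => φ.1.toOV)
      satLength satCmd (by simp [satLength, Cmd.EmitFree, Basic.EmitFree])
      (fun φ mem => by
        change DecisionAnswer _ mem → DecisionAnswer _ mem
        rw [CNF.toOV_hasOrthogonalPair]; exact id) 5 _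
      (fun φ w h1 h2 h3 => φ.1.transforms_toOV φ.2 (φ.1.lt_wordLength hK hε h1) h2 h3)
      fun φ => φ.1.toOV_time_le φ.2 hε0.le hε C
  exact hk 2 ⟨_, key⟩

/-! ### The lower bounds -/

theorem SafetyInstance.m_le_length (x : SafetyInstance) : x.m ≤ x.encode.length := by
  have : x.m = ((List.finRange x.n).map fun v => (x.mdp.succ v).card).sum := by
    rw [m, MDP.numEdges, ← List.ofFn_eq_map, List.sum_ofFn]
  rw [this, encode, List.length_append, List.length_cons, List.length_flatMap]
  refine le_trans (List.sum_le_sum fun v _ => ?_) ((Nat.le_succ _).trans (Nat.le_add_right _ _))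
  simp [encodeFinset]; omega

theorem OVInstance.one_le_m (x : OVInstance) : 1 ≤ x.toSafety.m := by
  change 1 ≤ x.toMDP.numEdges
  exact (Finset.card_pos.2 (x.toMDP.succ_nonempty x.start)).trans_le
    (Finset.single_le_sum (f := fun v => (x.toMDP.succ v).card) (fun _ _ => Nat.zero_le _)
      (Finset.mem_univ x.start))

theorem OVInstance.m_le (x : OVInstance) :
    (x.toSafety.m : ℝ) ≤ 24 * (((x.d : ℝ) + 1) * ((x.N : ℝ) + 1)) := by
  exact_mod_cast x.toSafety.m_le_length.trans (length_safetyEncode_le x)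

theorem OVInstance.k_le (x : OVInstance) : (x.toSafety.k : ℝ) ≤ (x.N : ℝ) + 1 := by
  have h : x.toSafety.k = x.S₂.length := List.length_map _
  rw [h]
  exact_mod_cast (le_max_right x.S₁.length x.S₂.length).trans (Nat.le_succ _)

/-- Here `576 = 24 ^ 2`. As `m ≥ 1`, lowering `ε` to `ε'` only increases the power, so large `ε`
with negative exponents are covered. -/
theorem OVInstance.m_rpow_le (x : OVInstance) {ε ε' : ℝ} (h : ε' ≤ ε) (h0 : 0 ≤ ε') (h1 : ε' ≤ 1) :
    (x.toSafety.m : ℝ) ^ (2 - ε) ≤ 576 * ovTime ε' x := by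
  have hm : (1 : ℝ) ≤ x.toSafety.m := by exact_mod_cast x.one_le_m
  have hd : (1 : ℝ) ≤ 24 * ((x.d : ℝ) + 1) := by
    have : (0 : ℝ) ≤ x.d := Nat.cast_nonneg _
    linarith
  calc (x.toSafety.m : ℝ) ^ (2 - ε) ≤ (x.toSafety.m : ℝ) ^ (2 - ε') :=
        Real.rpow_le_rpow_of_exponent_le hm (by linarith)
    _ ≤ (24 * ((x.d : ℝ) + 1) * ((x.N : ℝ) + 1)) ^ (2 - ε') :=
        Real.rpow_le_rpow (by positivity) (by rw [mul_assoc]; exact x.m_le) (by linarith)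
    _ = (24 * ((x.d : ℝ) + 1)) ^ (2 - ε') * ((x.N : ℝ) + 1) ^ (2 - ε') :=
        Real.mul_rpow (by positivity) (by positivity)
    _ ≤ (24 * ((x.d : ℝ) + 1)) ^ (2 : ℝ) * ((x.N : ℝ) + 1) ^ (2 - ε') := by
        gcongr
        · linarith
    _ = 576 * ovTime ε' x := by
        rw [ovTime, Real.rpow_two]; ring

theorem OVInstance.k_mul_m_rpow_le (x : OVInstance) {ε ε' : ℝ} (h : ε' ≤ ε) (h0 : 0 ≤ ε')
    (h1 : ε' ≤ 1) :
    ((x.toSafety.k : ℝ) * x.toSafety.m) ^ (1 - ε) ≤ 576 * ovTime ε' x := by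
  have hm : (1 : ℝ) ≤ x.toSafety.m := by exact_mod_cast x.one_le_m
  have hN : (1 : ℝ) ≤ (x.N : ℝ) + 1 := by simp
  have hd : (1 : ℝ) ≤ (x.d : ℝ) + 1 := by simp
  -- Without targets the base is 0, where powers are not monotone in the exponent; `0 ^ (1 - ε)` is
  -- 0 or 1.
  rcases Nat.eq_zero_or_pos x.toSafety.k with hk | hk
  · have h2 := le_ovTime h1 x
    have h3 := one_le_mul_of_one_le_of_one_le hd hN
    rw [hk, Nat.cast_zero, zero_mul]
    have := Real.zero_rpow_le_one (1 - ε)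
    linarith
  have hk : (1 : ℝ) ≤ x.toSafety.k := by exact_mod_cast hk
  have hkm := one_le_mul_of_one_le_of_one_le hk hm
  have hd' : (1 : ℝ) ≤ 24 * ((x.d : ℝ) + 1) := by linarith
  calc ((x.toSafety.k : ℝ) * x.toSafety.m) ^ (1 - ε)
      ≤ ((x.toSafety.k : ℝ) * x.toSafety.m) ^ (1 - ε') :=
        Real.rpow_le_rpow_of_exponent_le hkm (by linarith)
    _ ≤ (24 * ((x.d : ℝ) + 1) * ((x.N : ℝ) + 1) ^ 2) ^ (1 - ε') := by
        refine Real.rpow_le_rpow (by positivity) ?_ (by linarith)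
        calc (x.toSafety.k : ℝ) * x.toSafety.m
            ≤ ((x.N : ℝ) + 1) * (24 * (((x.d : ℝ) + 1) * ((x.N : ℝ) + 1))) := by
              gcongr
              · exact x.k_le
              · exact x.m_le
          _ = _ := by ring
    _ = (24 * ((x.d : ℝ) + 1)) ^ (1 - ε') * (((x.N : ℝ) + 1) ^ 2) ^ (1 - ε') :=
        Real.mul_rpow (by positivity) (by positivity)
    _ ≤ (24 * ((x.d : ℝ) + 1)) ^ (2 : ℝ) * ((x.N : ℝ) + 1) ^ (2 - ε') := by
        rw [← Real.rpow_natCast, ← Real.rpow_mul (by positivity)]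
        gcongr ?_ * ?_
        · exact Real.rpow_le_rpow_of_exponent_le hd' (by linarith)
        · exact Real.rpow_le_rpow_of_exponent_le hN (by push_cast; linarith)
    _ = 576 * ovTime ε' x := by
        rw [ovTime, Real.rpow_two]; ring

/-- Problems to which orthogonal vectors reduces in this way are hard. -/
theorem noFastAlgorithm_of_reduction (h : OVC ∨ SETH) {Q : Problem} (inst : Q.Inst → SafetyInstance)
    (f : OVInstance → Q.Inst) (b : Bool) (hinst : ∀ x, inst (f x) = x.toSafety)
    (hencode : ∀ x, Q.encode (f x) = (if b then [0] else []) ++ x.toSafety.encode)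
    (hcorrect : ∀ x mem, Q.Correct (f x) mem → DecisionAnswer x.HasOrthogonalPair mem) :
    NoFastAlgorithm Q inst := by
  have key {ε : ℝ} (hε : 0 < ε) (g : SafetyInstance → ℝ)
      (hg : ∀ x : OVInstance, g x.toSafety ≤ 576 * ovTime (min ε 1) x)
      (hg0 : ∀ x, 0 ≤ g x) : ¬ Q.SolvableInBigO fun x => Q.length x + g (inst x) := by
    rintro ⟨C, hC⟩
    -- Capping `ε` at 1 keeps `ovTime` at least linear, so that it also absorbs the input length and
    -- the cost of the reduction.
    have h0 : 0 < min ε 1 := lt_min hε one_pos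
    have h1 : min ε 1 ≤ 1 := min_le_right _ _
    have hOV := orthogonalVectors_solvable hC f b hencode hcorrect (K := |C| * 601) h1 fun x => by
      have hlen : (Q.length (f x) : ℝ) ≤ 25 * ovTime (min ε 1) x := by
        have h2 : Q.length (f x) ≤ 1 + 24 * ((x.d + 1) * (x.N + 1)) := by
          rw [Problem.length, hencode, List.length_append]
          have := length_safetyEncode_le x
          cases b <;> simp <;> omega
        have h3 : (Q.length (f x) : ℝ) ≤ 1 + 24 * (((x.d : ℝ) + 1) * ((x.N : ℝ) + 1)) := by
          exact_mod_cast h2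
        have h4 := le_ovTime h1 x
        have h5 : (1 : ℝ) ≤ ((x.d : ℝ) + 1) * ((x.N : ℝ) + 1) :=
          one_le_mul_of_one_le_of_one_le (by simp) (by simp)
        linarith
      beta_reduce
      rw [hinst]
      have hg0 := hg0 x.toSafety
      calc C * (Q.length (f x) + g x.toSafety)
          ≤ |C| * (25 * ovTime (min ε 1) x + 576 * ovTime (min ε 1) x) := by
            gcongr
            · exact le_abs_self C
            · exact hg x
        _ = _ := by ring
    rcases h with h | h
    · exact not_OVC_of_solvable h0 hOV h
    · exact not_SETH_of_solvable h0 h1 hOV h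
  intro ε hε
  have h0 : 0 ≤ min ε 1 := (lt_min hε one_pos).le
  exact ⟨key hε (fun x => (x.m : ℝ) ^ (2 - ε))
      (fun x => x.m_rpow_le (min_le_left _ _) h0 (min_le_right _ _)) fun x => by positivity,
    key hε (fun x => ((x.k : ℝ) * x.m) ^ (1 - ε))
      (fun x => x.k_mul_m_rpow_le (min_le_left _ _) h0 (min_le_right _ _)) fun x => by positivity⟩

theorem OVInstance.start_mem_winningSet (x : OVInstance) (D : Disjunction) :
    x.start ∈ x.toSafety.winningSet D ↔ x.HasOrthogonalPair := by
  constructor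
  · intro h
    by_contra hx
    have h' := x.toSafety.winningSet_subset_objective D h
    rw [x.winningSet_objective_eq_empty hx] at h'
    exact h'
  · exact fun h => x.toSafety.winningSet_query_subset D (x.start_mem_winningSet_query h)

theorem OVInstance.winningSet_nonempty (x : OVInstance) (D : Disjunction) :
    (x.toSafety.winningSet D).Nonempty ↔ x.HasOrthogonalPair := by
  constructor
  · rintro ⟨v, h⟩
    by_contra hx
    have h' := x.toSafety.winningSet_subset_objective D h
    rw [x.winningSet_objective_eq_empty hx] at h'
    exact h'
  · exact fun h => ⟨x.start, (x.start_mem_winningSet D).2 h⟩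

end SafetyHardness

end

/-! ### The main theorem -/

theorem mainTheorem5 (h : SafetyHardness.OVC ∨ SafetyHardness.SETH)
    (D : SafetyHardness.Disjunction) :
    SafetyHardness.NoFastAlgorithm (SafetyHardness.winningSetProblem D) (fun x => x) ∧
    SafetyHardness.NoFastAlgorithm (SafetyHardness.nonemptinessProblem D) (fun x => x) ∧
    SafetyHardness.NoFastAlgorithm (SafetyHardness.membershipProblem D) (fun y => y.1) := by
  refine ⟨?_, ?_, ?_⟩
  · refine SafetyHardness.noFastAlgorithm_of_reduction h _ (fun x => x.toSafety) false
      (fun _ => rfl) (fun _ => rfl) fun x mem hmem => ?_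
    -- The start is vertex `0`, so its entry in the computed winning set is the memory cell of a
    -- decision answer.
    have hx : SafetyHardness.DecisionAnswer (x.start ∈ x.toSafety.winningSet D) mem := hmem x.start
    rwa [x.start_mem_winningSet D] at hx
  · refine SafetyHardness.noFastAlgorithm_of_reduction h _ (fun x => x.toSafety) false
      (fun _ => rfl) (fun _ => rfl) fun x mem hmem => ?_
    change SafetyHardness.DecisionAnswer (x.toSafety.winningSet D).Nonempty mem at hmem
    rwa [x.winningSet_nonempty D] at hmem
  -- The flag `true` prepends a 0 to the encoding, the number of the start vertex as the query
  -- vertex.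
  · refine SafetyHardness.noFastAlgorithm_of_reduction h _ (fun x => ⟨x.toSafety, x.start⟩) true
      (fun _ => rfl) (fun _ => rfl) fun x mem hmem => ?_
    change SafetyHardness.DecisionAnswer (x.start ∈ x.toSafety.winningSet D) mem at hmem
    rwa [x.start_mem_winningSet D] at hmem
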